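/- Let $R>0$, $0<\alpha<1$, and let $D=\{z\in\mathbb C:|z|\le R\}$ be the closed disk. Let $C^\alpha(D)$ be the set of functions $f:D\to\mathbb C$ with $\sup_{z\ne z'\in D}|f(z)-f(z')|/|z-z'|^\alpha<\infty$. For an integer $k\ge 1$, let $C^{k+\alpha}(D)$ be the set of functions that are $k$ times continuously differentiable on $D$ in the real sense (derivatives at boundary points are taken within $D$) and whose partial derivatives $\partial^i\bar\partial^j f$ with $i+j=k$ all belong to $C^\alpha(D)$, where $\partial=\frac12(\partial_x-i\partial_y)$ and $\bar\partial=\frac12(\partial_x+i\partial_y)$. Define, for $z\in D$, $$Tf(z)=\frac{-1}{2\pi i}\int_D\frac{f(\zeta)}{\zeta-z}\,d\bar\zeta\wedge d\zeta,\qquad \overline Tf(z)=\frac{-1}{2\pi i}\int_D\frac{f(\zeta)}{\bar\zeta-\bar z}\,d\bar\zeta\wedge d\zeta,$$ where $d\bar\zeta\wedge d\zeta=2i\,dx\wedge dy$ for $\zeta=x+iy$ and $D$ has its standard orientation, and let $T^k$, $\overline T^k$ be the $k$-fold compositions. Then for every $f\in C^\alpha(D)$ and every integer $k>0$, all the integrals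 defining $T^kf$, $\overline T^kf$ and those below converge absolutely for every $z\in D$, we have $T^kf,\ \overline T^kf\in C^{k+\alpha}(D)$, and for every $z\in D$ $$T^kf(z)=\frac{(-1)^k}{(k-1)!\cdot 2\pi i}\int_D\frac{(\bar\zeta-\bar z)^{k-1}f(\zeta)}{\zeta-z}\,d\bar\zeta\wedge d\zeta,$$ $$\overline T^kf(z)=\frac{(-1)^k}{(k-1)!\cdot 2\pi i}\int_D\frac{(\zeta-z)^{k-1}f(\zeta)}{\bar\zeta-\bar z}\,d\bar\zeta\wedge d\zeta.$$ -/

import Mathlib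

open scoped NNReal

noncomputable section

namespace DiskGreen

/-- The closed disk `{z ∈ ℂ : |z| ≤ R}`. -/
def disk (R : ℝ) : Set ℂ := Metric.closedBall 0 R

/-- The constant-coefficient real 2-form `dζ̄ ∧ dζ` on `ℂ = ℝ²`, evaluated on two tangent vectors. -/
def conjWedge (v w : ℂ) : ℂ := starRingEnd ℂ v * w - starRingEnd ℂ w * v

/-- The value of `dζ̄ ∧ dζ` on the standard oriented orthonormal frame is `2i`, that is
`dζ̄ ∧ dζ = 2i dx ∧ dy`. -/
theorem conjWedge_one_I : conjWedge 1 Complex.I = 2 * Complex.I := by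
  simp [conjWedge]; ring

/-- The integral `∫_S g dζ̄ ∧ dζ` of a 2-form over a region `S` of the plane with its standard
orientation: coefficient on the oriented orthonormal frame `(1, i)`, against Lebesgue measure. -/
def wedgeIntegral (S : Set ℂ) (g : ℂ → ℂ) : ℂ := ∫ ζ in S, g ζ * conjWedge 1 Complex.I

/-- `T f(z) = -1/(2πi) ∫_D f(ζ)/(ζ - z) dζ̄ ∧ dζ`. -/
def opT (R : ℝ) (f : ℂ → ℂ) (z : ℂ) : ℂ :=
  -1 / (2 * Real.pi * Complex.I) * wedgeIntegral (disk R) (fun ζ => f ζ / (ζ - z))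

/-- `T̄ f(z) = -1/(2πi) ∫_D f(ζ)/(ζ̄ - z̄) dζ̄ ∧ dζ`. -/
def opTbar (R : ℝ) (f : ℂ → ℂ) (z : ℂ) : ℂ :=
  -1 / (2 * Real.pi * Complex.I) *
    wedgeIntegral (disk R) (fun ζ => f ζ / (starRingEnd ℂ ζ - starRingEnd ℂ z))

/-- `∂ f = ½ (∂f/∂x - i ∂f/∂y)`, derivatives being taken within the closed disk (so one-sided
at the boundary circle). -/
def dz (R : ℝ) (f : ℂ → ℂ) (z : ℂ) : ℂ :=
  (fderivWithin ℝ f (disk R) z 1 - Complex.I * fderivWithin ℝ f (disk R) z Complex.I) / 2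

/-- `∂̄ f = ½ (∂f/∂x + i ∂f/∂y)`, derivatives being taken within the closed disk. -/
def dzbar (R : ℝ) (f : ℂ → ℂ) (z : ℂ) : ℂ :=
  (fderivWithin ℝ f (disk R) z 1 + Complex.I * fderivWithin ℝ f (disk R) z Complex.I) / 2

/-- `f ∈ C^α(D)`: the restriction of `f` to the closed disk has finite Hölder constant
`H_α[f] = sup |f(z) - f(z')| / |z - z'|^α`. -/
def MemCAlpha (R : ℝ) (α : ℝ≥0) (f : ℂ → ℂ) : Prop :=
  ∃ C : ℝ≥0, HolderOnWith C α f (disk R)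

/-- `f ∈ C^{k+α}(D)`: `f` is `k` times continuously differentiable on the closed disk, and all
its derivatives `∂^i ∂̄^j f` of order `i + j = k` belong to `C^α(D)`. -/
def MemCkAlpha (R : ℝ) (k : ℕ) (α : ℝ≥0) (f : ℂ → ℂ) : Prop :=
  ContDiffOn ℝ k f (disk R) ∧
    ∀ i j : ℕ, i + j = k → MemCAlpha R α ((dz R)^[i] ((dzbar R)^[j] f))

end DiskGreen

end

/-! Everything reduces to potentials on the disk with kernel `ū ^ m / u ^ n`, `u = w - z`. There are
two independent halves.

Formula. Composing the Cauchy kernel `1 / (ζ - z)` with `(w̄ - ζ̄) ^ m / (w - ζ)` and splitting into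
partial fractions leaves Cauchy transforms of polynomials in `ζ̄`. These are explicit, because on a
circle `ζ̄ = r² / ζ` and Cauchy's formula applies (`integral_disk_pow_div_conj_sub`). The result is
`π / (m + 1)` times `(w̄ - z̄) ^ (m + 1) / (w - z)`, so Fubini and induction show that `T ^ (k + 1)
f` is a constant times the potential with kernel `ū ^ k / u`.

Regularity. A Wirtinger derivative in `z` lowers the degree `m - n` of the kernel by one, so after
`k` derivatives only kernels of the critical degree `-1` remain. For these,
`exists_norm_potential_taylor_le` gives a first order expansion with uniform error `O(|z - z₀| ^ (1
+ α))`: the density is replaced by `f(w) - f(z₀)`, and a Taylor bound for the kernel leaves the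
convergent integral of `|u| ^ (α - 2) |u - h|⁻¹`. By `memCAlpha_of_taylor` such an expansion makes
the coefficients Hölder, hence gains one derivative. The constant part `f(z₀)` requires the critical
potential of `1` to be a multiple of `z̄`; this is explicit for the Cauchy kernel, and for the
others follows by differentiating antiholomorphic potentials (`potential_add_two_one_eq_zero`).

The operator `T̄` is the conjugate of `T` under `f ↦ f̄`. -/

namespace DiskGreen

open MeasureTheory ComplexConjugate

/-! ### Taylor estimates for the kernels -/

/-- The kernel `ū ^ m / u ^ n`. -/
noncomputable def conjKer (m n : ℕ) (u : ℂ) : ℂ := conj u ^ m / u ^ n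

theorem norm_conjKer (m n : ℕ) (u : ℂ) : ‖conjKer m n u‖ = ‖u‖ ^ m / ‖u‖ ^ n := by
  simp [conjKer]

theorem measurable_conjKer (m n : ℕ) : Measurable (conjKer m n) := by
  unfold conjKer
  have : Measurable fun u : ℂ => conj u := Complex.continuous_conj.measurable
  fun_prop

theorem norm_conj_sub_self_le (t : ℂ) : ‖t - conj t‖ ≤ 2 * ‖t‖ := by
  calc ‖t - conj t‖ ≤ ‖t‖ + ‖conj t‖ := norm_sub_le _ _
    _ = 2 * ‖t‖ := by rw [Complex.norm_conj]; ring

theorem norm_conj_div_self {u : ℂ} (hu : u ≠ 0) : ‖conj u / u‖ = 1 := by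
  rw [norm_div, Complex.norm_conj, div_self (norm_ne_zero_iff.2 hu)]

/-- For `|t| ≤ 1/2` the denominator is at least `1/2`; for larger `t` the trivial bound `2` is
already at most `4|t|`. Hence no smallness of `t` is needed. -/
theorem norm_conj_div_self_sub_one_le {t : ℂ} (ht : t ≠ 1) :
    ‖conj (1 - t) / (1 - t) - 1‖ ≤ 4 * ‖t‖ := by
  have h1 : 1 - t ≠ 0 := sub_ne_zero.2 (Ne.symm ht)
  rcases le_total ‖t‖ (1 / 2) with h | h
  · have e : conj (1 - t) / (1 - t) - 1 = (t - conj t) / (1 - t) := by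
      field_simp; simp
    have h2 : 1 / 2 ≤ ‖1 - t‖ := by
      have := norm_sub_norm_le (1 : ℂ) t
      rw [norm_one] at this; linarith
    rw [e, norm_div, div_le_iff₀ (by linarith)]
    have := norm_conj_sub_self_le t
    nlinarith [norm_nonneg t]
  · calc ‖conj (1 - t) / (1 - t) - 1‖ ≤ ‖conj (1 - t) / (1 - t)‖ + ‖(1 : ℂ)‖ := norm_sub_le _ _
      _ = 2 := by rw [norm_conj_div_self h1, norm_one]; norm_num
      _ ≤ 4 * ‖t‖ := by linarith

/-- With `ω` the unimodular quotient, `ω - 1 - (t - t̄) = (ω - 1) t` is quadratic in `t`. The two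
bounds are proved together because the inductive step of the second uses the first; `4m² + 4 + 8m =
4(m + 1)²` closes it. -/
theorem norm_conj_div_self_pow_sub_le {t : ℂ} (ht : t ≠ 1) (m : ℕ) :
    ‖(conj (1 - t) / (1 - t)) ^ m - 1‖ ≤ 4 * m * ‖t‖ ∧
    ‖(conj (1 - t) / (1 - t)) ^ m - 1 - m * (t - conj t)‖ ≤ 4 * m ^ 2 * ‖t‖ ^ 2 := by
  have h1 : 1 - t ≠ 0 := sub_ne_zero.2 (Ne.symm ht)
  set ω := conj (1 - t) / (1 - t) with hω
  have hω1 : ‖ω‖ = 1 := norm_conj_div_self h1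
  have hω2 : ‖ω - 1‖ ≤ 4 * ‖t‖ := norm_conj_div_self_sub_one_le ht
  have hω3 : ω - 1 - (t - conj t) = (ω - 1) * t := by
    have : ω * (1 - t) = 1 - conj t := by rw [hω]; field_simp; simp
    linear_combination this
  induction m with
  | zero => simp
  | succ m ih =>
    obtain ⟨ih1, ih2⟩ := ih
    have ht0 := norm_nonneg t
    constructor
    · have e : ω ^ (m + 1) - 1 = ω ^ m * (ω - 1) + (ω ^ m - 1) := by ring
      calc ‖ω ^ (m + 1) - 1‖ ≤ ‖ω ^ m * (ω - 1)‖ + ‖ω ^ m - 1‖ := by rw [e]; exact norm_add_le _ _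
        _ ≤ 4 * ‖t‖ + 4 * m * ‖t‖ := by
          rw [norm_mul, norm_pow, hω1, one_pow, one_mul]; gcongr
        _ = _ := by push_cast; ring
    · have e : ω ^ (m + 1) - 1 - ((m + 1 : ℕ) : ℂ) * (t - conj t) =
          (ω ^ m - 1 - m * (t - conj t)) + ω ^ m * ((ω - 1) * t)
            + (t - conj t) * (ω ^ m - 1) := by
        rw [← hω3]; push_cast; ring
      calc _ ≤ ‖ω ^ m - 1 - m * (t - conj t)‖ + ‖ω ^ m * ((ω - 1) * t)‖
            + ‖(t - conj t) * (ω ^ m - 1)‖ := by rw [e]; exact norm_add₃_le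
        _ ≤ 4 * m ^ 2 * ‖t‖ ^ 2 + 4 * ‖t‖ * ‖t‖ + 2 * ‖t‖ * (4 * m * ‖t‖) := by
          rw [norm_mul, norm_mul, norm_mul, norm_pow, hω1, one_pow, one_mul]
          gcongr
          exact norm_conj_sub_self_le t
        _ = _ := by push_cast; ring

/-- Second order Taylor bound for the kernels of degree `-1`, valid without any restriction on the
relative size of `u` and `h`. -/
theorem norm_conjKer_taylor_le (m : ℕ) {u h : ℂ} (hu : u ≠ 0) (huh : u ≠ h) :
    ‖conjKer m (m + 1) (u - h) - conjKer m (m + 1) u - (m + 1) * conjKer m (m + 2) u * h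
        + m * conjKer (m - 1) (m + 1) u * conj h‖
      ≤ (4 * m ^ 2 + 2 * m + 1) * (‖h‖ ^ 2 * (‖u‖ ^ 2)⁻¹ * ‖u - h‖⁻¹) := by
  -- By homogeneity only the ratio `t = h / u` matters; the factor `1 / (1 - t)` produces `‖u -
  -- h‖⁻¹`.
  obtain ⟨t, rfl⟩ : ∃ t, h = t * u := ⟨h / u, by field_simp⟩
  have ht : t ≠ 1 := by rintro rfl; simp at huh
  have h1 : 1 - t ≠ 0 := sub_ne_zero.2 (Ne.symm ht)
  have e : conjKer m (m + 1) (u - t * u) - conjKer m (m + 1) u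
      - (m + 1) * conjKer m (m + 2) u * (t * u)
      + m * conjKer (m - 1) (m + 1) u * conj (t * u) =
      conj u ^ m / u ^ (m + 1) / (1 - t) * (((conj (1 - t) / (1 - t)) ^ m - 1 - m * (t - conj t))
        + (m + 1) * t ^ 2 - m * (t * conj t)) := by
    have e1 : u - t * u = (1 - t) * u := by ring
    have e2 : (m : ℂ) * conjKer (m - 1) (m + 1) u * conj (t * u) =
        m * (conj u ^ m / u ^ (m + 1)) * conj t := by
      -- At `m = 0` the truncated exponent `m - 1` is harmless, since its coefficient is `0`.
      rcases m with _ | m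
      · simp
      · simp [conjKer]; field_simp; ring
    rw [e2, e1]
    simp only [conjKer, map_mul, mul_pow, div_pow]
    field_simp
    ring
  have key := (norm_conj_div_self_pow_sub_le ht m).2
  have hu' : 0 < ‖u‖ := norm_pos_iff.2 hu
  have h1' : 0 < ‖1 - t‖ := norm_pos_iff.2 h1
  have b : ‖((conj (1 - t) / (1 - t)) ^ m - 1 - m * (t - conj t))
        + (m + 1) * t ^ 2 - m * (t * conj t)‖ ≤ (4 * m ^ 2 + 2 * m + 1) * ‖t‖ ^ 2 := by
    have n1 : ‖((m : ℂ) + 1) * t ^ 2‖ = (m + 1) * ‖t‖ ^ 2 := by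
      rw [norm_mul, norm_pow]; congr 1; exact_mod_cast Complex.norm_natCast (m + 1)
    have n2 : ‖(m : ℂ) * (t * conj t)‖ = m * ‖t‖ ^ 2 := by
      rw [norm_mul, norm_mul, Complex.norm_conj, Complex.norm_natCast]; ring
    calc _ ≤ ‖(conj (1 - t) / (1 - t)) ^ m - 1 - m * (t - conj t)‖ + ‖((m : ℂ) + 1) * t ^ 2‖
          + ‖(m : ℂ) * (t * conj t)‖ := (norm_sub_le _ _).trans (by gcongr; exact norm_add_le _ _)
      _ ≤ 4 * m ^ 2 * ‖t‖ ^ 2 + (m + 1) * ‖t‖ ^ 2 + m * ‖t‖ ^ 2 := by rw [n1, n2]; gcongr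
      _ = _ := by ring
  rw [e, norm_mul, norm_div, norm_div, norm_pow, norm_pow, Complex.norm_conj]
  have e3 : ‖u - t * u‖ = ‖1 - t‖ * ‖u‖ := by rw [← norm_mul]; congr 1; ring
  calc _ ≤ ‖u‖ ^ m / ‖u‖ ^ (m + 1) / ‖1 - t‖ * ((4 * m ^ 2 + 2 * m + 1) * ‖t‖ ^ 2) := by gcongr
    _ = _ := by rw [e3, norm_mul]; field_simp; ring

/-! ### Integrals of singular powers over the plane -/

theorem integrableOn_norm_sub_rpow {s : ℝ} (hs : -2 < s) (R : ℝ) (z : ℂ) :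
    IntegrableOn (fun w : ℂ => ‖w - z‖ ^ s) (disk R) := by
  have h : IntegrableOn (fun w : ℂ => ‖w‖ ^ s) (Metric.ball 0 (|R| + ‖z‖ + 1)) := by
    rw [integrableOn_fun_norm_addHaar volume (f := fun r => r ^ s)]
    have h2 : IntegrableOn (fun y : ℝ => y ^ (s + 1)) (Set.Ioo 0 (|R| + ‖z‖ + 1)) :=
      ((intervalIntegral.intervalIntegrable_rpow' (by linarith)).1).mono_set
        Set.Ioo_subset_Ioc_self
    refine h2.congr_fun (fun y hy => ?_) measurableSet_Ioo
    simp [Complex.finrank_real_complex, Real.rpow_add hy.1, mul_comm]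
  have h3 := ((integrable_indicator_iff Metric.isOpen_ball.measurableSet).2 h).comp_sub_right z
  refine h3.integrableOn.congr_fun (fun w hw => ?_) Metric.isClosed_closedBall.measurableSet
  have : w - z ∈ Metric.ball (0 : ℂ) (|R| + ‖z‖ + 1) := by
    have hw' : ‖w‖ ≤ R := by simpa [disk] using hw
    have := norm_sub_le w z
    have := le_abs_self R
    rw [mem_ball_zero_iff]; linarith
  simp [Set.indicator_of_mem this]

/-- In polar coordinates the integrand is `r ^ (β - 1) / (1 + r)`: the origin needs `β > 0`,
infinity needs `β < 1`. -/
theorem integrable_norm_rpow_div_one_add {β : ℝ} (h0 : 0 < β) (h1 : β < 1) :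
    Integrable (fun v : ℂ => ‖v‖ ^ (β - 2) / (1 + ‖v‖)) := by
  rw [integrable_fun_norm_addHaar volume (f := fun r => r ^ (β - 2) / (1 + r)),
    ← Set.Ioc_union_Ioi_eq_Ioi zero_le_one]
  have hm : Measurable fun y : ℝ =>
      y ^ (Module.finrank ℝ ℂ - 1) • (y ^ (β - 2) / (1 + y)) := by fun_prop
  refine IntegrableOn.union ?_ ?_
  · have h2 : IntegrableOn (fun y : ℝ => y ^ (β - 1)) (Set.Ioc 0 1) :=
      (intervalIntegral.intervalIntegrable_rpow' (by linarith)).1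
    refine Integrable.mono' h2 hm.aestronglyMeasurable ?_
    filter_upwards [ae_restrict_mem measurableSet_Ioc] with y hy
    have hp := Real.rpow_nonneg hy.1.le (β - 2)
    have hy0 := hy.1
    rw [Real.norm_of_nonneg (by positivity), show β - 1 = (β - 2) + 1 by ring,
      Real.rpow_add hy.1, Complex.finrank_real_complex]
    simp only [Nat.add_one_sub_one, pow_one, Real.rpow_one, smul_eq_mul]
    rw [mul_comm]
    gcongr
    exact div_le_self hp (by linarith)
  · have h2 : IntegrableOn (fun y : ℝ => y ^ (β - 2)) (Set.Ioi 1) :=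
      integrableOn_Ioi_rpow_of_lt (by linarith) one_pos
    refine Integrable.mono' h2 hm.aestronglyMeasurable ?_
    filter_upwards [ae_restrict_mem measurableSet_Ioi] with y hy
    have hy0 : 0 < y := one_pos.trans hy
    have hp := Real.rpow_nonneg hy0.le (β - 2)
    rw [Real.norm_of_nonneg (by positivity), Complex.finrank_real_complex]
    simp only [Nat.add_one_sub_one, pow_one, smul_eq_mul]
    rw [mul_div_assoc', div_le_iff₀ (by linarith)]
    nlinarith

theorem norm_rpow_div_add_eq {β δ : ℝ} (hδ : 0 < δ) (v : ℂ) :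
    ‖v‖ ^ (β - 2) / (δ + ‖v‖) =
      δ ^ (β - 3) * (‖δ⁻¹ • v‖ ^ (β - 2) / (1 + ‖δ⁻¹ • v‖)) := by
  have hd : 0 < δ ^ (β - 2) := Real.rpow_pos_of_pos hδ _
  rw [norm_smul, Real.norm_of_nonneg (by positivity), Real.mul_rpow (by positivity) (by positivity),
    Real.inv_rpow hδ.le, show β - 3 = (β - 2) - 1 by ring, Real.rpow_sub_one hδ.ne']
  field_simp

theorem integrable_norm_rpow_div_add {β δ : ℝ} (h0 : 0 < β) (h1 : β < 1) (hδ : 0 < δ) :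
    Integrable (fun v : ℂ => ‖v‖ ^ (β - 2) / (δ + ‖v‖)) := by
  simp_rw [norm_rpow_div_add_eq hδ]
  exact ((integrable_norm_rpow_div_one_add h0 h1).comp_smul (inv_ne_zero hδ.ne')).const_mul _

theorem integral_norm_rpow_div_add {β δ : ℝ} (hδ : 0 < δ) :
    ∫ v : ℂ, ‖v‖ ^ (β - 2) / (δ + ‖v‖) =
      δ ^ (β - 1) * ∫ v : ℂ, ‖v‖ ^ (β - 2) / (1 + ‖v‖) := by
  simp_rw [norm_rpow_div_add_eq hδ]
  rw [integral_const_mul, Measure.integral_comp_inv_smul volume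
    (fun v : ℂ => ‖v‖ ^ (β - 2) / (1 + ‖v‖)), Complex.finrank_real_complex,
    abs_of_pos (by positivity), smul_eq_mul, ← mul_assoc]
  congr 1
  rw [show β - 1 = (β - 3) + (2 : ℕ) by push_cast; ring, Real.rpow_add hδ, Real.rpow_natCast]

/-- Separates the singularities at `0` and `h` into two translates of one integrand. Whichever of
`‖u‖`, `‖u - h‖` is larger is at least a third of `‖h‖` plus the smaller one; when `u` is nearer to
`h`, monotonicity of `r ^ (β - 1)` moves the exponent to the other factor. -/
theorem norm_rpow_mul_inv_le {β : ℝ} (h1 : β < 1) {u h : ℂ} (hu : u ≠ 0) (huh : u ≠ h) :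
    ‖u‖ ^ (β - 2) * ‖u - h‖⁻¹ ≤
      3 * (‖u‖ ^ (β - 2) / (‖h‖ + ‖u‖) + ‖u - h‖ ^ (β - 2) / (‖h‖ + ‖u - h‖)) := by
  have hu' : 0 < ‖u‖ := norm_pos_iff.2 hu
  have hs : 0 < ‖u - h‖ := norm_pos_iff.2 (sub_ne_zero.2 huh)
  have tri : ‖h‖ ≤ ‖u‖ + ‖u - h‖ := by simpa using norm_sub_le u (u - h)
  have hh := norm_nonneg h
  have p1 := Real.rpow_pos_of_pos hu' (β - 2)
  have p2 := Real.rpow_pos_of_pos hs (β - 2)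
  rw [mul_add]
  rcases le_total ‖u‖ ‖u - h‖ with hle | hle
  · refine le_add_of_le_of_nonneg ?_ (by positivity)
    rw [← div_eq_mul_inv, mul_div_assoc', div_le_div_iff₀ hs (by positivity)]
    nlinarith
  · refine le_add_of_nonneg_of_le (by positivity) ?_
    have q : ‖u‖ ^ (β - 1) ≤ ‖u - h‖ ^ (β - 1) :=
      Real.rpow_le_rpow_of_nonpos hs hle (by linarith)
    have e1 : ‖u‖ ^ (β - 1) = ‖u‖ ^ (β - 2) * ‖u‖ := by
      rw [← Real.rpow_add_one hu'.ne']; congr 1; ring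
    have e2 : ‖u - h‖ ^ (β - 1) = ‖u - h‖ ^ (β - 2) * ‖u - h‖ := by
      rw [← Real.rpow_add_one hs.ne']; congr 1; ring
    rw [e1, e2] at q
    rw [← div_eq_mul_inv, mul_div_assoc', div_le_div_iff₀ hs (by positivity)]
    calc ‖u‖ ^ (β - 2) * (‖h‖ + ‖u - h‖) ≤ ‖u‖ ^ (β - 2) * (3 * ‖u‖) := by gcongr; linarith
      _ = 3 * (‖u‖ ^ (β - 2) * ‖u‖) := by ring
      _ ≤ 3 * (‖u - h‖ ^ (β - 2) * ‖u - h‖) := by gcongr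
      _ = _ := by ring

/-- The integral of `|u| ^ (β - 2) |u - h|⁻¹` over the plane is `O(|h| ^ (β - 1))`. -/
theorem exists_integral_norm_rpow_mul_inv_le {β : ℝ} (h0 : 0 < β) (h1 : β < 1) :
    ∃ C : ℝ, 0 ≤ C ∧ ∀ h : ℂ, h ≠ 0 →
      Integrable (fun u : ℂ => ‖u‖ ^ (β - 2) * ‖u - h‖⁻¹) ∧
      ∫ u : ℂ, ‖u‖ ^ (β - 2) * ‖u - h‖⁻¹ ≤ C * ‖h‖ ^ (β - 1) := by
  refine ⟨6 * ∫ v : ℂ, ‖v‖ ^ (β - 2) / (1 + ‖v‖), ?_, fun h hh => ?_⟩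
  · have : 0 ≤ ∫ v : ℂ, ‖v‖ ^ (β - 2) / (1 + ‖v‖) := integral_nonneg fun v => by positivity
    positivity
  have hδ : 0 < ‖h‖ := norm_pos_iff.2 hh
  have i1 := integrable_norm_rpow_div_add h0 h1 hδ
  have i2 := i1.comp_sub_right h
  have i3 := (i1.add i2).const_mul 3
  have hae : ∀ᵐ u : ℂ, ‖u‖ ^ (β - 2) * ‖u - h‖⁻¹ ≤
      3 * (‖u‖ ^ (β - 2) / (‖h‖ + ‖u‖) + ‖u - h‖ ^ (β - 2) / (‖h‖ + ‖u - h‖)) := by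
    filter_upwards [compl_mem_ae_iff.2 (measure_singleton (0 : ℂ)),
      compl_mem_ae_iff.2 (measure_singleton h)] with u hu huh
    exact norm_rpow_mul_inv_le h1 hu huh
  have i4 : Integrable (fun u : ℂ => ‖u‖ ^ (β - 2) * ‖u - h‖⁻¹) := by
    refine i3.mono' (by fun_prop) ?_
    filter_upwards [hae] with u hu
    rw [Real.norm_of_nonneg (by positivity)]
    exact hu
  refine ⟨i4, (integral_mono_ae i4 i3 hae).trans_eq ?_⟩
  simp only [Pi.add_apply]
  rw [integral_const_mul, integral_add i1 i2,
    integral_sub_right_eq_self (fun u : ℂ => ‖u‖ ^ (β - 2) / (‖h‖ + ‖u‖)),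
    integral_norm_rpow_div_add hδ]
  ring

/-! ### Circle averages and Cauchy transforms of polynomials -/

theorem measurableSet_disk (R : ℝ) : MeasurableSet (disk R) :=
  Metric.isClosed_closedBall.measurableSet

theorem mem_disk {R : ℝ} {z : ℂ} : z ∈ disk R ↔ ‖z‖ ≤ R := mem_closedBall_zero_iff

theorem isCompact_disk (R : ℝ) : IsCompact (disk R) := isCompact_closedBall 0 R

instance (R : ℝ) : IsFiniteMeasure (volume.restrict (disk R)) :=
  ⟨by simpa using (isCompact_disk R).measure_lt_top⟩

theorem measurePreserving_rotation_disk (R : ℝ) (c : Circle) :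
    MeasurePreserving (rotation c) (volume.restrict (disk R)) (volume.restrict (disk R)) := by
  have h := (rotation c).measurePreserving.restrict_preimage (measurableSet_disk R)
  have e : rotation c ⁻¹' disk R = disk R := by
    ext z; rw [Set.mem_preimage, mem_disk, mem_disk, LinearIsometryEquiv.norm_map]
  rwa [e] at h

theorem circleAverage_eq_integral_rotation (F : ℂ → ℂ) (z : ℂ) :
    Real.circleAverage F 0 ‖z‖ =
      (2 * Real.pi)⁻¹ • ∫ θ in Set.Ioc 0 (2 * Real.pi), F (rotation (Circle.exp θ) z) := by
  -- Starting the circle at the argument of `z` makes its points the rotations of `z` itself.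
  rw [Real.circleAverage_eq_integral_add z.arg,
    intervalIntegral.integral_of_le Real.two_pi_pos.le]
  congr 2
  ext θ
  congr 1
  rw [rotation_apply, Circle.coe_exp, circleMap, zero_add]
  conv_rhs => rw [← Complex.norm_mul_exp_arg_mul_I z]
  push_cast
  rw [add_mul, Complex.exp_add]
  ring

/-- Integrating over the disk amounts to integrating the averages over concentric circles. -/
theorem setIntegral_disk_eq_circleAverage {R : ℝ} {F : ℂ → ℂ} (hF : Measurable F)
    (hi : IntegrableOn F (disk R)) :
    ∫ z in disk R, F z = ∫ z in disk R, Real.circleAverage F 0 ‖z‖ := by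
  have hmeas : Measurable fun p : ℝ × ℂ => F (rotation (Circle.exp p.1) p.2) := by
    refine hF.comp (Continuous.measurable ?_)
    simp only [rotation_apply]
    fun_prop
  have hint : Integrable (Function.uncurry fun (θ : ℝ) (z : ℂ) => F (rotation (Circle.exp θ) z))
      ((volume.restrict (Set.Ioc 0 (2 * Real.pi))).prod (volume.restrict (disk R))) := by
    refine (integrable_prod_iff hmeas.aestronglyMeasurable).2 ⟨?_, ?_⟩
    · exact Filter.Eventually.of_forall fun θ =>
        ((measurePreserving_rotation_disk R (Circle.exp θ)).integrable_comp_emb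
          (rotation (Circle.exp θ)).toHomeomorph.measurableEmbedding).2 hi
    · have : ∀ θ : ℝ, ∫ z in disk R, ‖F (rotation (Circle.exp θ) z)‖ = ∫ z in disk R, ‖F z‖ :=
        fun θ => (measurePreserving_rotation_disk R (Circle.exp θ)).integral_comp
          (rotation (Circle.exp θ)).toHomeomorph.measurableEmbedding (fun z => ‖F z‖)
      simp only [this]
      exact integrable_const _
  simp_rw [circleAverage_eq_integral_rotation]
  rw [integral_smul, ← integral_integral_swap hint]
  have : ∀ θ : ℝ, ∫ z in disk R, F (rotation (Circle.exp θ) z) = ∫ z in disk R, F z :=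
    fun θ => (measurePreserving_rotation_disk R (Circle.exp θ)).integral_comp
      (rotation (Circle.exp θ)).toHomeomorph.measurableEmbedding F
  simp_rw [this]
  rw [setIntegral_const]
  simp only [Measure.real, Real.volume_Ioc, sub_zero, smul_smul]
  rw [ENNReal.toReal_ofReal Real.two_pi_pos.le, inv_mul_cancel₀ Real.two_pi_pos.ne', one_smul]

theorem conj_eq_of_mem_sphere {r : ℝ} {ζ : ℂ} (h : ζ ∈ Metric.sphere (0 : ℂ) r) :
    ζ * conj ζ = r ^ 2 := by
  rw [Complex.mul_conj, Complex.normSq_eq_norm_sq, mem_sphere_zero_iff_norm.1 h]; norm_cast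

/-- On the circle `ζ̄ = r² / ζ`, so the integrand equals `ζ ^ (m + 1) / (r² - z̄ ζ)`, with its pole
at `r² / z̄`. If `r < |z|` the pole lies inside and Cauchy's formula evaluates there; if `r > |z|`
the function is holomorphic on the closed disk and the average is its value `0` at the centre. -/
theorem circleAverage_pow_div_conj_sub {m : ℕ} {z : ℂ} {r : ℝ} (hr : 0 < r) (hrz : r ≠ ‖z‖) :
    Real.circleAverage (fun ζ => ζ ^ m / (conj ζ - conj z)) 0 r =
      if r < ‖z‖ then -(r ^ (2 * m) : ℂ) / conj z ^ (m + 1) else 0 := by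
  have hr' : (r : ℂ) ≠ 0 := by exact_mod_cast hr.ne'
  split_ifs with h
  · have hz : z ≠ 0 := by rintro rfl; simp at h; linarith
    have hz' : conj z ≠ 0 := by simpa using hz
    have hz'' : 0 < ‖z‖ := norm_pos_iff.2 hz
    have key := DiffContOnCl.circleAverage_smul_div (f := fun ζ : ℂ => -(1 / conj z) * ζ ^ m)
      (R := r) (c := 0) (w := r ^ 2 / conj z)
      (Differentiable.diffContOnCl (by fun_prop)) (by
        rw [abs_of_pos hr, mem_ball_zero_iff, norm_div, Complex.norm_conj, div_lt_iff₀ hz'']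
        simp only [norm_pow, Complex.norm_real, Real.norm_of_nonneg hr.le]
        nlinarith)
    refine Eq.trans (Real.circleAverage_congr_sphere fun ζ hζ => ?_) (key.trans ?_)
    · rw [abs_of_pos hr] at hζ
      have hs := conj_eq_of_mem_sphere hζ
      have hζ0 : ζ ≠ 0 := by
        rintro rfl; simp at hζ; exact hr.ne hζ
      have hne : conj ζ - conj z ≠ 0 := by
        rw [← map_sub]
        simp only [ne_eq, map_eq_zero, sub_eq_zero]
        rintro rfl; exact hrz (by simpa using hζ.symm)
      have e : ζ - r ^ 2 / conj z = - ζ * (conj ζ - conj z) / conj z := by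
        field_simp; linear_combination hs
      simp only [smul_eq_mul, sub_zero]
      rw [e]; field_simp
    · simp only [div_pow]; field_simp; ring
  · have hrz' : ‖z‖ < r := lt_of_le_of_ne (not_lt.1 h) (Ne.symm hrz)
    have hne : ∀ ζ ∈ Metric.closedBall (0 : ℂ) |r|, (r : ℂ) ^ 2 - conj z * ζ ≠ 0 := by
      intro ζ hζ h0
      rw [abs_of_pos hr, mem_closedBall_zero_iff] at hζ
      have : ‖(r : ℂ) ^ 2‖ = ‖conj z * ζ‖ := by rw [sub_eq_zero.1 h0]
      simp only [norm_pow, norm_mul, Complex.norm_real, Complex.norm_conj,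
        Real.norm_of_nonneg hr.le] at this
      nlinarith [norm_nonneg z, norm_nonneg ζ]
    have key := DiffContOnCl.circleAverage
      (f := fun ζ : ℂ => ζ ^ (m + 1) / (r ^ 2 - conj z * ζ)) (R := r) (c := 0) (by
        have hd : DifferentiableOn ℂ (fun ζ : ℂ => ζ ^ (m + 1) / (r ^ 2 - conj z * ζ))
            (closure (Metric.ball 0 |r|)) :=
          DifferentiableOn.div (by fun_prop) (by fun_prop)
            fun ζ hζ => hne ζ (Metric.closure_ball_subset_closedBall hζ)
        exact hd.diffContOnCl)
    refine Eq.trans (Real.circleAverage_congr_sphere fun ζ hζ => ?_) (key.trans (by simp))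
    have hne' := hne ζ (Metric.sphere_subset_closedBall hζ)
    rw [abs_of_pos hr] at hζ
    have hs := conj_eq_of_mem_sphere hζ
    have e : (r : ℂ) ^ 2 - conj z * ζ = ζ * (conj ζ - conj z) := by linear_combination -hs
    simp only [e] at hne' ⊢
    have h1 := left_ne_zero_of_mul hne'
    have h2 := right_ne_zero_of_mul hne'
    field_simp
    ring

theorem integral_ball_norm_pow (m : ℕ) {ρ : ℝ} (hρ : 0 ≤ ρ) :
    ∫ z in Metric.ball (0 : ℂ) ρ, ‖z‖ ^ (2 * m) = Real.pi * ρ ^ (2 * m + 2) / (m + 1) := by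
  have h := integral_fun_norm_addHaar (volume : Measure ℂ)
    (fun r => (Set.Iio ρ).indicator (fun r : ℝ => r ^ (2 * m)) r)
  have e1 : (fun z : ℂ => (Set.Iio ρ).indicator (fun r : ℝ => r ^ (2 * m)) ‖z‖) =
      (Metric.ball (0 : ℂ) ρ).indicator fun z => ‖z‖ ^ (2 * m) := by
    ext z
    by_cases hz : ‖z‖ < ρ
    · rw [Set.indicator_of_mem (Set.mem_Iio.2 hz), Set.indicator_of_mem (mem_ball_zero_iff.2 hz)]
    · rw [Set.indicator_of_notMem (by simpa using hz), Set.indicator_of_notMem (by simpa using hz)]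
  have e2 : (fun y : ℝ => y ^ (Module.finrank ℝ ℂ - 1) •
      (Set.Iio ρ).indicator (fun r : ℝ => r ^ (2 * m)) y) =
      (Set.Iio ρ).indicator fun y => y ^ (2 * m + 1) := by
    ext y; simp [Set.indicator_apply, Complex.finrank_real_complex, pow_succ, mul_comm]
  rw [e1, e2, integral_indicator Metric.isOpen_ball.measurableSet,
    setIntegral_indicator measurableSet_Iio, Set.Ioi_inter_Iio, ← integral_Ioc_eq_integral_Ioo,
    ← intervalIntegral.integral_of_le hρ, integral_pow] at h
  rw [h]
  have : volume.real (Metric.ball (0 : ℂ) 1) = Real.pi := by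
    simp [Measure.real, Complex.volume_ball]
  rw [this, Complex.finrank_real_complex]
  push_cast
  have : (m : ℝ) + 1 ≠ 0 := by positivity
  simp only [smul_eq_mul, nsmul_eq_mul]
  rw [zero_pow (by omega)]
  field_simp
  push_cast
  ring

theorem integrableOn_pow_div_conj_sub (R : ℝ) (m : ℕ) (z : ℂ) :
    IntegrableOn (fun ζ => ζ ^ m / (conj ζ - conj z)) (disk R) := by
  have h := ((integrableOn_norm_sub_rpow (s := -1) (by norm_num) R z).const_mul (R ^ m))
  refine h.mono' ?_ ?_
  · have : Measurable fun u : ℂ => conj u := Complex.continuous_conj.measurable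
    exact Measurable.aestronglyMeasurable (by fun_prop)
  · filter_upwards [ae_restrict_mem (measurableSet_disk R)] with ζ hζ
    rw [mem_disk] at hζ
    rw [← map_sub, norm_div, norm_pow, Complex.norm_conj, Real.rpow_neg_one, ← div_eq_mul_inv]
    gcongr

/-- The Cauchy transform of a monomial over the disk. -/
theorem integral_disk_pow_div_conj_sub {R : ℝ} (m : ℕ) {z : ℂ} (hz : z ∈ disk R) :
    ∫ ζ in disk R, ζ ^ m / (conj ζ - conj z) = -Real.pi * z ^ (m + 1) / (m + 1) := by
  have hmeas : Measurable fun ζ : ℂ => ζ ^ m / (conj ζ - conj z) := by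
    have : Measurable fun u : ℂ => conj u := Complex.continuous_conj.measurable
    fun_prop
  rw [setIntegral_disk_eq_circleAverage hmeas (integrableOn_pow_div_conj_sub R m z)]
  have hsph : volume (Metric.sphere (0 : ℂ) ‖z‖) = 0 := Measure.addHaar_sphere _ _ _
  -- Only circles of radius less than `|z|` contribute; the circle through `z` and the origin are
  -- null sets.
  have hae : ∀ᵐ ζ ∂(volume.restrict (disk R)),
      Real.circleAverage (fun ζ => ζ ^ m / (conj ζ - conj z)) 0 ‖ζ‖ =
      (Metric.ball (0 : ℂ) ‖z‖).indicator
        (fun ζ => -1 / conj z ^ (m + 1) * ((‖ζ‖ ^ (2 * m) : ℝ) : ℂ)) ζ := by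
    refine ae_restrict_of_ae ?_
    filter_upwards [compl_mem_ae_iff.2 hsph, compl_mem_ae_iff.2 (measure_singleton (0 : ℂ))]
      with ζ h1 h2
    rw [circleAverage_pow_div_conj_sub (norm_pos_iff.2 h2) (by simpa using h1)]
    split_ifs with h3
    · rw [Set.indicator_of_mem (mem_ball_zero_iff.2 h3)]; push_cast; ring
    · rw [Set.indicator_of_notMem (by simpa using h3)]
  rw [integral_congr_ae hae, setIntegral_indicator Metric.isOpen_ball.measurableSet]
  have : disk R ∩ Metric.ball 0 ‖z‖ = Metric.ball 0 ‖z‖ := by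
    refine Set.inter_eq_right.2 fun ζ hζ => ?_
    rw [mem_ball_zero_iff] at hζ
    exact mem_disk.2 (hζ.le.trans (mem_disk.1 hz))
  rw [this, integral_const_mul, integral_complex_ofReal, integral_ball_norm_pow m (norm_nonneg z)]
  rcases eq_or_ne z 0 with rfl | hz0
  · simp
  have hz' : conj z ≠ 0 := by simpa using hz0
  have h1 : ((‖z‖ ^ 2 : ℝ) : ℂ) = z * conj z := by
    rw [Complex.mul_conj, Complex.normSq_eq_norm_sq]
  have h2 : ((Real.pi * ‖z‖ ^ (2 * m + 2) / (m + 1) : ℝ) : ℂ) =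
      Real.pi * (z * conj z) ^ (m + 1) / (m + 1) := by
    rw [← h1]; push_cast; ring
  rw [h2, mul_pow]
  field_simp

theorem integral_disk_conj_pow_div_sub {R : ℝ} (m : ℕ) {z : ℂ} (hz : z ∈ disk R) :
    ∫ ζ in disk R, conj ζ ^ m / (ζ - z) = -Real.pi * conj z ^ (m + 1) / (m + 1) := by
  have h := congrArg conj (integral_disk_pow_div_conj_sub m hz)
  rw [← integral_conj] at h
  simpa using h

theorem integrableOn_conj_pow_div_sub (R : ℝ) (m : ℕ) (z : ℂ) :
    IntegrableOn (fun ζ => conj ζ ^ m / (ζ - z)) (disk R) := by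
  have h := Complex.conjCLE.toContinuousLinearMap.integrable_comp
    (integrableOn_pow_div_conj_sub R m z)
  refine h.congr (Filter.Eventually.of_forall fun ζ => ?_)
  simp

/-- The Cauchy transform of `(w̄ - ζ̄) ^ m` over the disk. -/
theorem integral_disk_conj_sub_pow_div_sub {R : ℝ} (m : ℕ) (w : ℂ) {z : ℂ} (hz : z ∈ disk R) :
    ∫ ζ in disk R, (conj w - conj ζ) ^ m / (ζ - z) =
      Real.pi * ((conj w - conj z) ^ (m + 1) - conj w ^ (m + 1)) / (m + 1) := by
  have hexp : ∀ ζ : ℂ, (conj w - conj ζ) ^ m / (ζ - z) = ∑ j ∈ Finset.range (m + 1),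
      ((-1) ^ j * conj w ^ (m - j) * m.choose j) * (conj ζ ^ j / (ζ - z)) := by
    intro ζ
    rw [show conj w - conj ζ = -conj ζ + conj w by ring, add_pow, Finset.sum_div]
    refine Finset.sum_congr rfl fun j _ => ?_
    rw [neg_pow]; ring
  simp_rw [hexp]
  rw [integral_finsetSum _ fun j _ => (integrableOn_conj_pow_div_sub R j z).const_mul _]
  simp_rw [integral_const_mul, integral_disk_conj_pow_div_sub _ hz]
  have hm : (m : ℂ) + 1 ≠ 0 := by exact_mod_cast Nat.succ_ne_zero m
  -- The `j = 0` term of the expansion of exponent `m + 1` is exactly the subtracted power of `w̄`;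
  -- the other terms match through `(m + 1) C(m, j) = (j + 1) C(m + 1, j + 1)`.
  conv_rhs => rw [show conj w - conj z = -conj z + conj w by ring, add_pow, Finset.sum_range_succ']
  simp only [pow_zero, Nat.sub_zero, Nat.choose_zero_right, one_mul, Nat.cast_one, mul_one,
    add_sub_cancel_right, Finset.mul_sum, Finset.sum_div]
  refine Finset.sum_congr rfl fun j _ => ?_
  have hj : (j : ℂ) + 1 ≠ 0 := by exact_mod_cast Nat.succ_ne_zero j
  have hc : ((m : ℂ) + 1) * m.choose j = (m + 1).choose (j + 1) * (j + 1) := by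
    exact_mod_cast Nat.add_one_mul_choose_eq m j
  rw [Nat.add_sub_add_right, neg_pow (conj z), pow_succ (-1 : ℂ) j]
  field_simp
  linear_combination -conj w ^ (m - j) * conj z ^ (j + 1) * hc

/-! ### The Hölder class on the disk -/

theorem memCAlpha_iff {R : ℝ} {α : ℝ≥0} {f : ℂ → ℂ} : MemCAlpha R α f ↔
    ∃ C : ℝ, 0 ≤ C ∧ ∀ z ∈ disk R, ∀ w ∈ disk R, ‖f z - f w‖ ≤ C * ‖z - w‖ ^ (α : ℝ) := by
  constructor
  · rintro ⟨C, hC⟩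
    refine ⟨C, C.2, fun z hz w hw => ?_⟩
    simpa [dist_eq_norm] using hC.dist_le hz hw
  · rintro ⟨C, hC0, hC⟩
    refine ⟨C.toNNReal, fun z hz w hw => ?_⟩
    rw [edist_dist, edist_dist, ENNReal.ofReal_rpow_of_nonneg dist_nonneg α.coe_nonneg,
      ← ENNReal.ofReal, ← ENNReal.ofReal_mul hC0]
    apply ENNReal.ofReal_le_ofReal
    simpa [dist_eq_norm] using hC z hz w hw

theorem MemCAlpha.continuousOn {R : ℝ} {α : ℝ≥0} {f : ℂ → ℂ} (hα : 0 < α)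
    (hf : MemCAlpha R α f) : ContinuousOn f (disk R) :=
  hf.elim fun _ hC => hC.continuousOn hα

theorem MemCAlpha.congr {R : ℝ} {α : ℝ≥0} {f g : ℂ → ℂ} (hf : MemCAlpha R α f)
    (h : Set.EqOn g f (disk R)) : MemCAlpha R α g := by
  obtain ⟨C, hC⟩ := hf
  refine ⟨C, fun z hz w hw => ?_⟩
  rw [h hz, h hw]; exact hC z hz w hw

theorem MemCAlpha.const_mul {R : ℝ} {α : ℝ≥0} {f : ℂ → ℂ} (hf : MemCAlpha R α f) (c : ℂ) :
    MemCAlpha R α fun z => c * f z := by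
  obtain ⟨C, hC0, hC⟩ := memCAlpha_iff.1 hf
  refine memCAlpha_iff.2 ⟨‖c‖ * C, by positivity, fun z hz w hw => ?_⟩
  rw [← mul_sub, norm_mul, mul_assoc]
  gcongr
  exact hC z hz w hw

theorem memCAlpha_const (R : ℝ) (α : ℝ≥0) (c : ℂ) : MemCAlpha R α fun _ => c :=
  memCAlpha_iff.2 ⟨0, le_rfl, fun z _ w _ => by simp⟩

theorem MemCAlpha.conj {R : ℝ} {α : ℝ≥0} {f : ℂ → ℂ} (hf : MemCAlpha R α f) :
    MemCAlpha R α fun z => conj (f z) := by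
  obtain ⟨C, hC0, hC⟩ := memCAlpha_iff.1 hf
  refine memCAlpha_iff.2 ⟨C, hC0, fun z hz w hw => ?_⟩
  rw [← map_sub, Complex.norm_conj]
  exact hC z hz w hw

theorem memCAlpha_of_lipschitz {R : ℝ} {α : ℝ≥0} (hα : α < 1) {f : ℂ → ℂ} {C : ℝ}
    (h : ∀ z ∈ disk R, ∀ w ∈ disk R, ‖f z - f w‖ ≤ C * ‖z - w‖) : MemCAlpha R α f := by
  refine memCAlpha_iff.2 ⟨|C| * (2 * |R|) ^ (1 - α : ℝ), by positivity, fun z hz w hw => ?_⟩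
  have hα' : (0 : ℝ) ≤ 1 - α := sub_nonneg.2 (by exact_mod_cast hα.le)
  have hzw : ‖z - w‖ ≤ 2 * |R| := by
    have := norm_sub_le z w
    have := mem_disk.1 hz
    have := mem_disk.1 hw
    have := le_abs_self R
    linarith
  rcases eq_or_ne z w with rfl | hne
  · simp; positivity
  have hp : 0 < ‖z - w‖ := norm_pos_iff.2 (sub_ne_zero.2 hne)
  calc ‖f z - f w‖ ≤ |C| * ‖z - w‖ := (h z hz w hw).trans (by gcongr; exact le_abs_self C)
    _ = |C| * (‖z - w‖ ^ (1 - α : ℝ) * ‖z - w‖ ^ (α : ℝ)) := by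
      rw [← Real.rpow_add hp, sub_add_cancel, Real.rpow_one]
    _ ≤ |C| * ((2 * |R|) ^ (1 - α : ℝ) * ‖z - w‖ ^ (α : ℝ)) := by gcongr
    _ = _ := by ring

theorem MemCAlpha.mul {R : ℝ} {α : ℝ≥0} (hα : 0 < α) {f g : ℂ → ℂ} (hf : MemCAlpha R α f)
    (hg : MemCAlpha R α g) : MemCAlpha R α fun z => f z * g z := by
  obtain ⟨Bf, hBf⟩ := (isCompact_disk R).exists_bound_of_continuousOn (hf.continuousOn hα)
  obtain ⟨Bg, hBg⟩ := (isCompact_disk R).exists_bound_of_continuousOn (hg.continuousOn hα)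
  obtain ⟨C, hC0, hC⟩ := memCAlpha_iff.1 hf
  obtain ⟨K, hK0, hK⟩ := memCAlpha_iff.1 hg
  refine memCAlpha_iff.2 ⟨|Bf| * K + |Bg| * C, by positivity, fun z hz w hw => ?_⟩
  calc ‖f z * g z - f w * g w‖ = ‖f z * (g z - g w) + g w * (f z - f w)‖ := by ring_nf
    _ ≤ ‖f z‖ * ‖g z - g w‖ + ‖g w‖ * ‖f z - f w‖ := by
      rw [← norm_mul, ← norm_mul]; exact norm_add_le _ _
    _ ≤ |Bf| * (K * ‖z - w‖ ^ (α : ℝ)) + |Bg| * (C * ‖z - w‖ ^ (α : ℝ)) := by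
      gcongr
      · exact (hBf z hz).trans (le_abs_self _)
      · exact hK z hz w hw
      · exact (hBg w hw).trans (le_abs_self _)
      · exact hC z hz w hw
    _ = _ := by ring

/-! ### Potentials and their first order expansion -/

/-- The weakly singular potential `∫_D conjKer m n (w - z) f(w)`. -/
noncomputable def potential (R : ℝ) (m n : ℕ) (f : ℂ → ℂ) (z : ℂ) : ℂ :=
  ∫ w in disk R, conjKer m n (w - z) * f w

/-- The regularised potential `∫_D conjKer m n (w - z) (f(w) - f(z))`. -/
noncomputable def regPotential (R : ℝ) (m n : ℕ) (f : ℂ → ℂ) (z : ℂ) : ℂ :=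
  ∫ w in disk R, conjKer m n (w - z) * (f w - f z)

theorem norm_sub_le_of_mem_disk {R : ℝ} {z w : ℂ} (hz : z ∈ disk R) (hw : w ∈ disk R) :
    ‖w - z‖ ≤ 2 * R := by
  have := norm_sub_le w z
  have := mem_disk.1 hz
  have := mem_disk.1 hw
  linarith

theorem ae_ne_disk (R : ℝ) (z : ℂ) : ∀ᵐ w ∂(volume.restrict (disk R)), w ≠ z :=
  ae_restrict_of_ae (compl_mem_ae_iff.2 (measure_singleton z))

theorem norm_conjKer_le {R : ℝ} {m n : ℕ} (hn : n ≤ m + 1) {z w : ℂ} (hz : z ∈ disk R)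
    (hw : w ∈ disk R) (hwz : w ≠ z) :
    ‖conjKer m n (w - z)‖ ≤ (2 * R) ^ (m + 1 - n) * ‖w - z‖ ^ (-1 : ℝ) := by
  have hp : 0 < ‖w - z‖ := norm_pos_iff.2 (sub_ne_zero.2 hwz)
  have hle := norm_sub_le_of_mem_disk hz hw
  obtain ⟨d, hd⟩ := Nat.exists_eq_add_of_le hn
  rw [norm_conjKer, Real.rpow_neg_one, hd, Nat.add_sub_cancel_left]
  calc ‖w - z‖ ^ m / ‖w - z‖ ^ n = ‖w - z‖ ^ d * ‖w - z‖⁻¹ := by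
        field_simp; rw [← pow_succ, hd, pow_add]
    _ ≤ _ := by gcongr

theorem aestronglyMeasurable_conjKer_sub (R : ℝ) (m n : ℕ) (z : ℂ) :
    AEStronglyMeasurable (fun w => conjKer m n (w - z)) (volume.restrict (disk R)) :=
  ((measurable_conjKer m n).comp (measurable_id.sub_const z)).aestronglyMeasurable

theorem integrableOn_conjKer_mul {R : ℝ} {m n : ℕ} (hn : n ≤ m + 1) {f : ℂ → ℂ}
    (hf : ContinuousOn f (disk R)) {z : ℂ} (hz : z ∈ disk R) :
    IntegrableOn (fun w => conjKer m n (w - z) * f w) (disk R) := by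
  obtain ⟨B, hB⟩ := (isCompact_disk R).exists_bound_of_continuousOn hf
  refine (((integrableOn_norm_sub_rpow (s := -1) (by norm_num) R z).const_mul
    ((2 * R) ^ (m + 1 - n))).mul_const B).mono'
    ((aestronglyMeasurable_conjKer_sub R m n z).mul
      (hf.aestronglyMeasurable (measurableSet_disk R))) ?_
  filter_upwards [ae_restrict_mem (measurableSet_disk R), ae_ne_disk R z] with w hw hwz
  have hR : 0 ≤ R := (norm_nonneg z).trans (mem_disk.1 hz)
  rw [norm_mul]
  gcongr
  · exact norm_conjKer_le hn hz hw hwz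
  · exact hB w hw

/-- In the critical case `n = m + 2` the kernel alone is not integrable, but the Hölder bound on `f
w - f z` improves the singularity to `‖w - z‖ ^ (α - 2)`. -/
theorem integrableOn_conjKer_mul_sub {R : ℝ} {α : ℝ≥0} (hα : 0 < α) {m n : ℕ} (hn : n ≤ m + 2)
    {f : ℂ → ℂ} (hf : MemCAlpha R α f) {z : ℂ} (hz : z ∈ disk R) :
    IntegrableOn (fun w => conjKer m n (w - z) * (f w - f z)) (disk R) := by
  have hfc : ContinuousOn (fun w => f w - f z) (disk R) :=
    (hf.continuousOn hα).sub continuousOn_const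
  rcases Nat.lt_or_ge n (m + 2) with h | h
  · exact integrableOn_conjKer_mul (by omega) hfc hz
  obtain rfl : n = m + 2 := le_antisymm hn h
  obtain ⟨C, hC0, hC⟩ := memCAlpha_iff.1 hf
  have hα' : (0 : ℝ) < α := by exact_mod_cast hα
  refine ((integrableOn_norm_sub_rpow (s := α - 2) (by linarith) R z).const_mul C).mono'
    ((aestronglyMeasurable_conjKer_sub R m _ z).mul
      (hfc.aestronglyMeasurable (measurableSet_disk R))) ?_
  filter_upwards [ae_restrict_mem (measurableSet_disk R), ae_ne_disk R z] with w hw hwz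
  have hp : 0 < ‖w - z‖ := norm_pos_iff.2 (sub_ne_zero.2 hwz)
  rw [norm_mul, norm_conjKer]
  calc _ ≤ ‖w - z‖ ^ m / ‖w - z‖ ^ (m + 2) * (C * ‖w - z‖ ^ (α : ℝ)) := by
        gcongr; exact hC w hw z hz
    _ = _ := by
      rw [Real.rpow_sub hp, show (2 : ℝ) = (2 : ℕ) by norm_num, Real.rpow_natCast]
      field_simp
      ring

theorem integral_sub_sub_const_mul_add_const_mul {μ : Measure ℂ} {F₁ F₂ F₃ F₄ : ℂ → ℂ}
    (h₁ : Integrable F₁ μ) (h₂ : Integrable F₂ μ) (h₃ : Integrable F₃ μ) (h₄ : Integrable F₄ μ)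
    (a b : ℂ) :
    ∫ w, F₁ w - F₂ w - a * F₃ w + b * F₄ w ∂μ =
      ∫ w, F₁ w ∂μ - ∫ w, F₂ w ∂μ - a * ∫ w, F₃ w ∂μ + b * ∫ w, F₄ w ∂μ := by
  have k₁ : Integrable (fun w => F₁ w - F₂ w) μ := h₁.sub h₂
  have k₂ : Integrable (fun w => F₁ w - F₂ w - a * F₃ w) μ := k₁.sub (h₃.const_mul a)
  rw [integral_add k₂ (h₄.const_mul b), integral_sub k₁ (h₃.const_mul a), integral_sub h₁ h₂,
    integral_const_mul, integral_const_mul]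

/-- First order expansion, with remainder `O(|z - z₀| ^ (1 + α))`, of the potential with kernel
`ū ^ m / u ^ (m + 1)` and Hölder continuous density. -/
theorem exists_norm_potential_taylor_le {R : ℝ} {α : ℝ≥0} (hα0 : 0 < α) (hα1 : α < 1) {m : ℕ}
    {c : ℂ} (hc : ∀ z ∈ disk R, potential R m (m + 1) (fun _ => 1) z = c * conj z) {f : ℂ → ℂ}
    (hf : MemCAlpha R α f) :
    ∃ C : ℝ, ∀ z ∈ disk R, ∀ z₀ ∈ disk R,
      ‖potential R m (m + 1) f z - potential R m (m + 1) f z₀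
        - (m + 1) * regPotential R m (m + 2) f z₀ * (z - z₀)
        - (-m * regPotential R (m - 1) (m + 1) f z₀ + c * f z₀) * conj (z - z₀)‖
      ≤ C * ‖z - z₀‖ ^ (1 + α : ℝ) := by
  have hα0' : (0 : ℝ) < α := by exact_mod_cast hα0
  have hα1' : (α : ℝ) < 1 := by exact_mod_cast hα1
  obtain ⟨H, hH0, hH⟩ := memCAlpha_iff.1 hf
  obtain ⟨A, hA0, hA⟩ := exists_integral_norm_rpow_mul_inv_le hα0' hα1'
  refine ⟨H * (4 * m ^ 2 + 2 * m + 1) * A, fun z hz z₀ hz₀ => ?_⟩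
  rcases eq_or_ne z z₀ with rfl | hne
  · simp [Real.zero_rpow (by positivity : (1 + α : ℝ) ≠ 0)]
  have hh : z - z₀ ≠ 0 := sub_ne_zero.2 hne
  have hh' : 0 < ‖z - z₀‖ := norm_pos_iff.2 hh
  have hfc := hf.continuousOn hα0
  have hfc' : ContinuousOn (fun w => f w - f z₀) (disk R) := hfc.sub continuousOn_const
  have i1 := integrableOn_conjKer_mul (m := m) (n := m + 1) le_rfl hfc' hz
  have i2 := integrableOn_conjKer_mul (m := m) (n := m + 1) le_rfl hfc' hz₀
  have i3 := integrableOn_conjKer_mul_sub hα0 (m := m) (n := m + 2) le_rfl hf hz₀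
  have i4 := integrableOn_conjKer_mul_sub hα0 (m := m - 1) (n := m + 1) (by omega) hf hz₀
  -- Freezing the density at `z₀` leaves the potential of a constant, which `hc` makes exactly
  -- linear in `z̄`; it therefore contributes only the term `c * f z₀` and no error.
  have split : ∀ x ∈ disk R, potential R m (m + 1) f x =
      (∫ w in disk R, conjKer m (m + 1) (w - x) * (f w - f z₀)) + f z₀ * (c * conj x) := by
    intro x hx
    rw [← hc x hx, potential, potential, ← integral_const_mul,
      ← integral_add (integrableOn_conjKer_mul le_rfl hfc' hx)
        ((integrableOn_conjKer_mul le_rfl continuousOn_const hx).const_mul _)]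
    congr 1; ext w; ring
  have e : potential R m (m + 1) f z - potential R m (m + 1) f z₀
        - (m + 1) * regPotential R m (m + 2) f z₀ * (z - z₀)
        - (-m * regPotential R (m - 1) (m + 1) f z₀ + c * f z₀) * conj (z - z₀) =
      ∫ w in disk R, (conjKer m (m + 1) ((w - z₀) - (z - z₀)) - conjKer m (m + 1) (w - z₀)
        - (m + 1) * conjKer m (m + 2) (w - z₀) * (z - z₀)
        + m * conjKer (m - 1) (m + 1) (w - z₀) * conj (z - z₀)) * (f w - f z₀) := by
    have e1 : ∀ w, (conjKer m (m + 1) ((w - z₀) - (z - z₀)) - conjKer m (m + 1) (w - z₀)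
        - (m + 1) * conjKer m (m + 2) (w - z₀) * (z - z₀)
        + m * conjKer (m - 1) (m + 1) (w - z₀) * conj (z - z₀)) * (f w - f z₀) =
        conjKer m (m + 1) (w - z) * (f w - f z₀) - conjKer m (m + 1) (w - z₀) * (f w - f z₀)
        - ((m + 1) * (z - z₀)) * (conjKer m (m + 2) (w - z₀) * (f w - f z₀))
        + (m * conj (z - z₀)) * (conjKer (m - 1) (m + 1) (w - z₀) * (f w - f z₀)) := by
      intro w; rw [sub_sub_sub_cancel_right]; ring
    simp_rw [e1]
    rw [integral_sub_sub_const_mul_add_const_mul i1 i2 i3 i4, split z hz, split z₀ hz₀, regPotential, regPotential, map_sub]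
    ring
  obtain ⟨j1, j2⟩ := hA _ hh
  have j3 := j1.comp_sub_right z₀
  rw [e]
  -- The kernel remainder times the Hölder bound, with `h = z - z₀`: the integral of the last two
  -- factors is `O(‖h‖ ^ (α - 1))`, which with `‖h‖ ^ 2` gives exponent `1 + α`.
  have bound : ∀ᵐ w ∂(volume.restrict (disk R)),
      ‖(conjKer m (m + 1) ((w - z₀) - (z - z₀)) - conjKer m (m + 1) (w - z₀)
        - (m + 1) * conjKer m (m + 2) (w - z₀) * (z - z₀)
        + m * conjKer (m - 1) (m + 1) (w - z₀) * conj (z - z₀)) * (f w - f z₀)‖ ≤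
      H * (4 * m ^ 2 + 2 * m + 1) * ‖z - z₀‖ ^ 2 *
        (‖w - z₀‖ ^ (α - 2 : ℝ) * ‖w - z₀ - (z - z₀)‖⁻¹) := by
    filter_upwards [ae_restrict_mem (measurableSet_disk R), ae_ne_disk R z, ae_ne_disk R z₀]
      with w hw hwz hwz₀
    have hu : w - z₀ ≠ 0 := sub_ne_zero.2 hwz₀
    have hp : 0 < ‖w - z₀‖ := norm_pos_iff.2 hu
    rw [norm_mul]
    calc _ ≤ (4 * m ^ 2 + 2 * m + 1) *
          (‖z - z₀‖ ^ 2 * (‖w - z₀‖ ^ 2)⁻¹ * ‖w - z₀ - (z - z₀)‖⁻¹) *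
          (H * ‖w - z₀‖ ^ (α : ℝ)) := by
          gcongr
          · exact norm_conjKer_taylor_le m hu fun h => hwz (sub_left_injective h)
          · exact hH w hw z₀ hz₀
      _ = _ := by
        rw [Real.rpow_sub hp, show (2 : ℝ) = (2 : ℕ) by norm_num, Real.rpow_natCast]
        field_simp
  refine (norm_integral_le_of_norm_le (j3.integrableOn.const_mul _) bound).trans ?_
  rw [integral_const_mul]
  calc _ ≤ H * (4 * m ^ 2 + 2 * m + 1) * ‖z - z₀‖ ^ 2 * (A * ‖z - z₀‖ ^ (α - 1 : ℝ)) := by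
        gcongr
        refine (setIntegral_le_integral j3 (Filter.Eventually.of_forall fun w => ?_)).trans ?_
        · positivity
        · rw [integral_sub_right_eq_self
            (fun u : ℂ => ‖u‖ ^ (α - 2 : ℝ) * ‖u - (z - z₀)‖⁻¹)]
          exact j2
    _ = _ := by
      rw [show (1 + α : ℝ) = (α - 1) + (2 : ℕ) by push_cast; ring, Real.rpow_add hh',
        Real.rpow_natCast]
      ring

/-! ### Wirtinger derivatives within the disk -/

theorem uniqueDiffOn_disk {R : ℝ} (hR : 0 < R) : UniqueDiffOn ℝ (disk R) := by
  refine uniqueDiffOn_convex (convex_closedBall 0 R) ⟨0, ?_⟩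
  exact mem_interior_iff_mem_nhds.2 (Metric.closedBall_mem_nhds 0 hR)

/-- The real-linear map `v ↦ a v + b v̄`. -/
noncomputable def wirtingerCLM (a b : ℂ) : ℂ →L[ℝ] ℂ :=
  a • ContinuousLinearMap.id ℝ ℂ + b • (Complex.conjCLE : ℂ →L[ℝ] ℂ)

@[simp]
theorem wirtingerCLM_apply (a b v : ℂ) : wirtingerCLM a b v = a * v + b * conj v := by
  simp [wirtingerCLM]

/-- `g` is real differentiable within the disk at `z`, with Wirtinger derivatives `a` and `b`. -/
def HasWirtingerAt (R : ℝ) (g : ℂ → ℂ) (a b z : ℂ) : Prop :=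
  HasFDerivWithinAt g (wirtingerCLM a b) (disk R) z

theorem HasWirtingerAt.dz_eq {R : ℝ} (hR : 0 < R) {g : ℂ → ℂ} {a b z : ℂ}
    (h : HasWirtingerAt R g a b z) (hz : z ∈ disk R) : dz R g z = a := by
  rw [dz, HasFDerivWithinAt.fderivWithin h (uniqueDiffOn_disk hR z hz)]
  simp only [wirtingerCLM_apply, map_one, Complex.conj_I]
  linear_combination (-(a - b) / 2) * Complex.I_sq

theorem HasWirtingerAt.dzbar_eq {R : ℝ} (hR : 0 < R) {g : ℂ → ℂ} {a b z : ℂ}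
    (h : HasWirtingerAt R g a b z) (hz : z ∈ disk R) : dzbar R g z = b := by
  rw [dzbar, HasFDerivWithinAt.fderivWithin h (uniqueDiffOn_disk hR z hz)]
  simp only [wirtingerCLM_apply, map_one, Complex.conj_I]
  linear_combination ((a - b) / 2) * Complex.I_sq

theorem HasWirtingerAt.congr {R : ℝ} {g g' : ℂ → ℂ} {a b z : ℂ} (h : HasWirtingerAt R g a b z)
    (e : Set.EqOn g' g (disk R)) (hz : z ∈ disk R) : HasWirtingerAt R g' a b z :=
  HasFDerivWithinAt.congr h e (e hz)

theorem HasWirtingerAt.sub {R : ℝ} {g g' : ℂ → ℂ} {a b a' b' z : ℂ}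
    (h : HasWirtingerAt R g a b z) (h' : HasWirtingerAt R g' a' b' z) :
    HasWirtingerAt R (fun w => g w - g' w) (a - a') (b - b') z := by
  refine (HasFDerivWithinAt.sub h h').congr_fderiv ?_
  ext
  simp
  ring

theorem HasWirtingerAt.const_mul {R : ℝ} {g : ℂ → ℂ} {a b z : ℂ}
    (h : HasWirtingerAt R g a b z) (c : ℂ) :
    HasWirtingerAt R (fun w => c * g w) (c * a) (c * b) z := by
  refine (HasFDerivWithinAt.const_mul h c).congr_fderiv ?_
  ext
  simp
  ring

theorem HasWirtingerAt.conj {R : ℝ} {g : ℂ → ℂ} {a b z : ℂ}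
    (h : HasWirtingerAt R g a b z) :
    HasWirtingerAt R (fun w => conj (g w)) (conj b) (conj a) z := by
  refine (Complex.conjCLE.toContinuousLinearMap.hasFDerivAt.comp_hasFDerivWithinAt z
    h).congr_fderiv ?_
  ext
  simp
  ring

theorem hasWirtingerAt_conj_pow (R : ℝ) (p : ℕ) (z : ℂ) :
    HasWirtingerAt R (fun w => conj w ^ p) 0 (p * conj z ^ (p - 1)) z := by
  have h : HasFDerivWithinAt (fun w : ℂ => conj w) (Complex.conjCLE : ℂ →L[ℝ] ℂ) (disk R) z :=
    Complex.conjCLE.toContinuousLinearMap.hasFDerivWithinAt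
  refine (h.pow p).congr_fderiv ?_
  ext
  simp

theorem HasWirtingerAt.conj_mul {R : ℝ} {g : ℂ → ℂ} {a b z : ℂ}
    (h : HasWirtingerAt R g a b z) :
    HasWirtingerAt R (fun w => starRingEnd ℂ w * g w) (starRingEnd ℂ z * a)
      (starRingEnd ℂ z * b + g z) z := by
  have h' : HasFDerivWithinAt (fun w : ℂ => starRingEnd ℂ w) (Complex.conjCLE : ℂ →L[ℝ] ℂ)
      (disk R) z := Complex.conjCLE.toContinuousLinearMap.hasFDerivWithinAt
  refine (h'.mul h).congr_fderiv ?_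
  ext
  simp
  ring

theorem hasWirtingerAt_of_taylor {R α C : ℝ} (hα : 0 < α) {g a b : ℂ → ℂ}
    (h : ∀ z ∈ disk R, ∀ z₀ ∈ disk R,
      ‖g z - g z₀ - a z₀ * (z - z₀) - b z₀ * conj (z - z₀)‖ ≤ C * ‖z - z₀‖ ^ (1 + α))
    {z₀ : ℂ} (hz₀ : z₀ ∈ disk R) : HasWirtingerAt R g (a z₀) (b z₀) z₀ := by
  refine HasFDerivWithinAt.of_isLittleO ?_
  have h1 : (fun z => g z - g z₀ - wirtingerCLM (a z₀) (b z₀) (z - z₀)) =O[nhdsWithin z₀ (disk R)]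
      fun z => ‖z - z₀‖ ^ (1 + α) := by
    refine Asymptotics.IsBigO.of_bound C ?_
    filter_upwards [self_mem_nhdsWithin] with z hz
    rw [Real.norm_of_nonneg (by positivity), wirtingerCLM_apply, ← sub_sub]
    exact h z hz z₀ hz₀
  refine h1.trans_isLittleO ?_
  have h2 : Filter.Tendsto (fun z => ‖z - z₀‖) (nhdsWithin z₀ (disk R)) (nhds 0) := by
    have : Continuous fun z : ℂ => ‖z - z₀‖ := by fun_prop
    have h := this.tendsto z₀
    rw [sub_self, norm_zero] at h
    exact h.mono_left nhdsWithin_le_nhds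
  have h3 : Filter.Tendsto (fun z => ‖z - z₀‖ ^ α) (nhdsWithin z₀ (disk R)) (nhds 0) := by
    have := h2.rpow_const (p := α) (Or.inr hα.le)
    rwa [Real.zero_rpow hα.ne'] at this
  have h4 : (fun z => ‖z - z₀‖ ^ (1 + α)) = fun z => ‖z - z₀‖ ^ α * ‖z - z₀‖ := by
    ext z
    rw [add_comm, Real.rpow_add_of_nonneg (norm_nonneg _) hα.le zero_le_one, Real.rpow_one]
  rw [h4]
  have h5 := (Asymptotics.isLittleO_one_iff ℝ).2 h3
  have h6 := h5.mul_isBigO (Asymptotics.isBigO_refl (fun z => ‖z - z₀‖) (nhdsWithin z₀ (disk R)))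
  simp only [one_mul] at h6
  exact h6.trans_isBigO (Asymptotics.isBigO_refl _ _).norm_left

/-- Uniform first order expansions with remainder `O(|z - z₀| ^ (1 + α))` force the derivatives to
be Hölder continuous of exponent `α`. -/
theorem memCAlpha_of_taylor {R : ℝ} (hR : 0 < R) {α : ℝ≥0} {C : ℝ} {g a b : ℂ → ℂ}
    (h : ∀ z ∈ disk R, ∀ z₀ ∈ disk R,
      ‖g z - g z₀ - a z₀ * (z - z₀) - b z₀ * conj (z - z₀)‖ ≤ C * ‖z - z₀‖ ^ (1 + α : ℝ)) :
    MemCAlpha R α a ∧ MemCAlpha R α b := by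
  -- Four expansion errors, each at distance at most `2δ`.
  set M : ℝ := 4 * |C| * 2 ^ (1 + α : ℝ) with hM
  have hα : (0 : ℝ) ≤ α := α.coe_nonneg
  have main : ∀ z₀ ∈ disk R, ∀ z₁ ∈ disk R, z₀ ≠ z₁ →
      ‖a z₀ - a z₁‖ ≤ 2 * M * ‖z₀ - z₁‖ ^ (α : ℝ) ∧
      ‖b z₀ - b z₁‖ ≤ 2 * M * ‖z₀ - z₁‖ ^ (α : ℝ) := by
    intro z₀ hz₀ z₁ hz₁ hne
    set δ := ‖z₀ - z₁‖ with hδ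
    have hδ0 : 0 < δ := norm_pos_iff.2 (sub_ne_zero.2 hne)
    have hδR : δ ≤ 2 * R := norm_sub_le_of_mem_disk hz₁ hz₀
    have hz₁' := mem_disk.1 hz₁
    have hs0 : 0 ≤ δ / (2 * R) := by positivity
    have hs1 : δ / (2 * R) ≤ 1 := (div_le_one (by positivity)).2 hδR
    -- `z₁` is pulled towards the origin by at most `δ / 2`, so that the ball of radius `δ / 2`
    -- about `p` stays inside the disk even when `z₁` is on the boundary.
    set p : ℂ := ((1 - δ / (2 * R) : ℝ) : ℂ) * z₁ with hp
    have hp1 : ‖p‖ ≤ R - δ / 2 := by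
      rw [hp, norm_mul, Complex.norm_real, Real.norm_of_nonneg (by linarith)]
      calc (1 - δ / (2 * R)) * ‖z₁‖ ≤ (1 - δ / (2 * R)) * R := by
            gcongr
        _ = R - δ / 2 := by field_simp
    have hp2 : ‖p - z₁‖ ≤ δ / 2 := by
      have : p - z₁ = -((δ / (2 * R) : ℝ) : ℂ) * z₁ := by rw [hp]; push_cast; ring
      rw [this, norm_mul, norm_neg, Complex.norm_real, Real.norm_of_nonneg hs0]
      calc δ / (2 * R) * ‖z₁‖ ≤ δ / (2 * R) * R := by gcongr
        _ = δ / 2 := by field_simp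
    have hE : ∀ v : ℂ, ‖v‖ ≤ δ / 2 → ∀ y ∈ disk R, (y = z₀ ∨ y = z₁) →
        ‖g (p + v) - g y - a y * (p + v - y) - b y * conj (p + v - y)‖ ≤
          |C| * (2 ^ (1 + α : ℝ) * δ ^ (1 + α : ℝ)) := by
      intro v hv y hy hy'
      have hq : p + v ∈ disk R := mem_disk.2 ((norm_add_le _ _).trans (by linarith))
      refine (h _ hq y hy).trans ?_
      rw [← Real.mul_rpow zero_le_two hδ0.le]
      have h1 : ‖p + v - z₁‖ ≤ δ := by
        rw [show p + v - z₁ = (p - z₁) + v by ring]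
        exact (norm_add_le _ _).trans (by linarith)
      have h2 : ‖p + v - y‖ ≤ 2 * δ := by
        rcases hy' with rfl | rfl
        · rw [show p + v - y = (p + v - z₁) - (y - z₁) by ring]
          exact (norm_sub_le _ _).trans (by linarith)
        · linarith
      gcongr
      exact le_abs_self C
    -- Comparing the expansions about `z₀` and `z₁` at `p + v` and at `p` cancels all values of `g`
    -- and leaves the difference of the two linear parts applied to `v`.
    have hL : ∀ v : ℂ, ‖v‖ ≤ δ / 2 →
        ‖(a z₀ - a z₁) * v + (b z₀ - b z₁) * conj v‖ ≤ M * δ ^ (1 + α : ℝ) := by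
      intro v hv
      have z : ‖(0 : ℂ)‖ ≤ δ / 2 := by rw [norm_zero]; positivity
      have e1 := hE v hv z₀ hz₀ (Or.inl rfl)
      have e2 := hE v hv z₁ hz₁ (Or.inr rfl)
      have e3 := hE 0 z z₀ hz₀ (Or.inl rfl)
      have e4 := hE 0 z z₁ hz₁ (Or.inr rfl)
      have e : (a z₀ - a z₁) * v + (b z₀ - b z₁) * conj v =
          ((g (p + 0) - g z₀ - a z₀ * (p + 0 - z₀) - b z₀ * conj (p + 0 - z₀)) -
          (g (p + v) - g z₀ - a z₀ * (p + v - z₀) - b z₀ * conj (p + v - z₀))) +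
          ((g (p + v) - g z₁ - a z₁ * (p + v - z₁) - b z₁ * conj (p + v - z₁)) -
          (g (p + 0) - g z₁ - a z₁ * (p + 0 - z₁) - b z₁ * conj (p + 0 - z₁))) := by
        simp only [map_add, map_sub, add_zero]; ring
      rw [e]
      refine (norm_add_le _ _).trans ((add_le_add (norm_sub_le _ _) (norm_sub_le _ _)).trans ?_)
      rw [hM]; linarith
    have hδα : δ ^ (1 + α : ℝ) = δ * δ ^ (α : ℝ) := by
      rw [Real.rpow_add hδ0, Real.rpow_one]
    -- Testing on `v = δ / 2` and `v = iδ / 2` isolates the sum and the difference of the two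
    -- coefficient increments.
    have f1 : ‖(a z₀ - a z₁) + (b z₀ - b z₁)‖ ≤ 2 * M * δ ^ (α : ℝ) := by
      have := hL ((δ / 2 : ℝ) : ℂ) (by
        rw [Complex.norm_real, Real.norm_of_nonneg (by positivity)])
      rw [Complex.conj_ofReal, ← add_mul, norm_mul, Complex.norm_real,
        Real.norm_of_nonneg (by positivity), hδα] at this
      refine le_of_mul_le_mul_right (this.trans_eq ?_) (by positivity : 0 < δ / 2)
      ring
    have f2 : ‖(a z₀ - a z₁) - (b z₀ - b z₁)‖ ≤ 2 * M * δ ^ (α : ℝ) := by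
      have := hL (((δ / 2 : ℝ) : ℂ) * Complex.I) (by
        rw [norm_mul, Complex.norm_I, mul_one, Complex.norm_real,
          Real.norm_of_nonneg (by positivity)])
      rw [map_mul, Complex.conj_ofReal, Complex.conj_I,
        show ∀ x y d : ℂ, x * (d * Complex.I) + y * (d * -Complex.I) = (x - y) * d * Complex.I by
          intros; ring, norm_mul, norm_mul, Complex.norm_real, Complex.norm_I, mul_one,
        Real.norm_of_nonneg (by positivity), hδα] at this
      refine le_of_mul_le_mul_right (this.trans_eq ?_) (by positivity : 0 < δ / 2)
      ring
    constructor
    · have := norm_add_le ((a z₀ - a z₁) + (b z₀ - b z₁)) ((a z₀ - a z₁) - (b z₀ - b z₁))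
      rw [show ((a z₀ - a z₁) + (b z₀ - b z₁)) + ((a z₀ - a z₁) - (b z₀ - b z₁)) =
        2 * (a z₀ - a z₁) by ring, norm_mul, Complex.norm_two] at this
      linarith
    · have := norm_sub_le ((a z₀ - a z₁) + (b z₀ - b z₁)) ((a z₀ - a z₁) - (b z₀ - b z₁))
      rw [show ((a z₀ - a z₁) + (b z₀ - b z₁)) - ((a z₀ - a z₁) - (b z₀ - b z₁)) =
        2 * (b z₀ - b z₁) by ring, norm_mul, Complex.norm_two] at this
      linarith
  have hM0 : 0 ≤ 2 * M := by positivity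
  constructor <;> refine memCAlpha_iff.2 ⟨2 * M, hM0, fun z hz w hw => ?_⟩ <;>
    rcases eq_or_ne z w with rfl | hne
  · simp only [sub_self, norm_zero]; positivity
  · exact (main z hz w hw hne).1
  · simp only [sub_self, norm_zero]; positivity
  · exact (main z hz w hw hne).2

/-! ### Iterated Wirtinger regularity -/

/-- `g` has Wirtinger derivatives of all types up to order `k` within the disk, those of order `k`
being Hölder continuous of exponent `α`. -/
def WirtingerRegular (R : ℝ) (α : ℝ≥0) : ℕ → (ℂ → ℂ) → Prop
  | 0, g => MemCAlpha R α g
  | k + 1, g => ∃ a b : ℂ → ℂ, (∀ z ∈ disk R, HasWirtingerAt R g (a z) (b z) z) ∧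
      WirtingerRegular R α k a ∧ WirtingerRegular R α k b

theorem WirtingerRegular.conj {R : ℝ} {α : ℝ≥0} {k : ℕ} {g : ℂ → ℂ} (h : WirtingerRegular R α k g) :
    WirtingerRegular R α k fun z => conj (g z) := by
  induction k generalizing g with
  | zero => exact MemCAlpha.conj h
  | succ k ih =>
    obtain ⟨a, b, hd, ha, hb⟩ := h
    exact ⟨_, _, fun z hz => (hd z hz).conj, ih hb, ih ha⟩

namespace WirtingerRegular

variable {R : ℝ} {α : ℝ≥0}

theorem congr {k : ℕ} {g g' : ℂ → ℂ} (h : WirtingerRegular R α k g)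
    (e : Set.EqOn g' g (disk R)) : WirtingerRegular R α k g' := by
  cases k with
  | zero => exact MemCAlpha.congr h e
  | succ k =>
    obtain ⟨a, b, hd, ha, hb⟩ := h
    exact ⟨a, b, fun z hz => (hd z hz).congr e hz, ha, hb⟩

theorem const_mul {k : ℕ} {g : ℂ → ℂ} (h : WirtingerRegular R α k g) (c : ℂ) :
    WirtingerRegular R α k fun z => c * g z := by
  induction k generalizing g with
  | zero => exact MemCAlpha.const_mul h c
  | succ k ih =>
    obtain ⟨a, b, hd, ha, hb⟩ := h
    exact ⟨_, _, fun z hz => (hd z hz).const_mul c, ih ha, ih hb⟩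

theorem contDiffOn (hR : 0 < R) (hα : 0 < α) {k : ℕ} {g : ℂ → ℂ}
    (h : WirtingerRegular R α k g) : ContDiffOn ℝ k g (disk R) := by
  induction k generalizing g with
  | zero => exact contDiffOn_zero.2 (MemCAlpha.continuousOn hα h)
  | succ k ih =>
    obtain ⟨a, b, hd, ha, hb⟩ := h
    push_cast
    -- The discharged clause concerns the analytic exponent `ω`. The derivative `wirtingerCLM (a z)
    -- (b z)` is linear in `a` and `b`, so it inherits their smoothness.
    refine (contDiffOn_succ_iff_hasFDerivWithinAt_of_uniqueDiffOn (uniqueDiffOn_disk hR)).2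
      ⟨fun h => absurd h (by simp), _, ?_, hd⟩
    exact ((ih ha).smul contDiffOn_const).add ((ih hb).smul contDiffOn_const)

theorem dz (hR : 0 < R) {k : ℕ} {g : ℂ → ℂ} (h : WirtingerRegular R α (k + 1) g) :
    WirtingerRegular R α k (dz R g) := by
  obtain ⟨a, b, hd, ha, hb⟩ := h
  exact ha.congr fun z hz => (hd z hz).dz_eq hR hz

theorem dzbar (hR : 0 < R) {k : ℕ} {g : ℂ → ℂ} (h : WirtingerRegular R α (k + 1) g) :
    WirtingerRegular R α k (dzbar R g) := by
  obtain ⟨a, b, hd, ha, hb⟩ := h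
  exact hb.congr fun z hz => (hd z hz).dzbar_eq hR hz

theorem dz_iterate (hR : 0 < R) {k : ℕ} (i : ℕ) {g : ℂ → ℂ}
    (h : WirtingerRegular R α (k + i) g) : WirtingerRegular R α k ((DiskGreen.dz R)^[i] g) := by
  induction i generalizing g with
  | zero => exact h
  | succ i ih => exact ih (h.dz hR)

theorem dzbar_iterate (hR : 0 < R) {k : ℕ} (i : ℕ) {g : ℂ → ℂ}
    (h : WirtingerRegular R α (k + i) g) :
    WirtingerRegular R α k ((DiskGreen.dzbar R)^[i] g) := by
  induction i generalizing g with
  | zero => exact h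
  | succ i ih => exact ih (h.dzbar hR)

theorem memCkAlpha (hR : 0 < R) (hα : 0 < α) {k : ℕ} {g : ℂ → ℂ}
    (h : WirtingerRegular R α k g) : MemCkAlpha R k α g := by
  refine ⟨h.contDiffOn hR hα, fun i j hij => ?_⟩
  subst hij
  have h1 : WirtingerRegular R α (0 + i) ((DiskGreen.dzbar R)^[j] g) :=
    dzbar_iterate hR j (by rwa [zero_add])
  exact dz_iterate hR i h1

end WirtingerRegular

/-! ### Differentiating potentials -/

theorem memCAlpha_conj_id (R : ℝ) {α : ℝ≥0} (hα : α < 1) : MemCAlpha R α fun w => conj w :=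
  memCAlpha_of_lipschitz hα (C := 1) fun z _ w _ => by
    rw [← map_sub, Complex.norm_conj, one_mul]

/-- Expanding one factor `w̄ - z̄` trades a power in the kernel for the density `w̄ f(w)`, which is
again Hölder; this drives the induction on `m`. -/
theorem potential_succ_left {R : ℝ} {m n : ℕ} (hn : n ≤ m + 1) {f : ℂ → ℂ}
    (hf : ContinuousOn f (disk R)) {z : ℂ} (hz : z ∈ disk R) :
    potential R (m + 1) n f z =
      potential R m n (fun w => conj w * f w) z - conj z * potential R m n f z := by
  have hc : ContinuousOn (fun w => conj w * f w) (disk R) :=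
    Complex.continuous_conj.continuousOn.mul hf
  rw [potential, potential, potential, ← integral_const_mul,
    ← integral_sub (integrableOn_conjKer_mul hn hc hz)
      ((integrableOn_conjKer_mul hn hf hz).const_mul _)]
  congr 1; ext w
  simp only [conjKer, map_sub]; ring

/-- The regularising constants cancel: `w̄ f(w) - z̄ f(z) - z̄ (f(w) - f(z)) = (w̄ - z̄) f(w)`. -/
theorem potential_succ_eq_regPotential {R : ℝ} {α : ℝ≥0} (hα0 : 0 < α) (hα1 : α < 1) {m n : ℕ}
    (hn : n ≤ m + 2) {f : ℂ → ℂ} (hf : MemCAlpha R α f) {z : ℂ} (hz : z ∈ disk R) :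
    potential R (m + 1) n f z =
      regPotential R m n (fun w => conj w * f w) z - conj z * regPotential R m n f z := by
  rw [potential, regPotential, regPotential, ← integral_const_mul,
    ← integral_sub (integrableOn_conjKer_mul_sub hα0 hn ((memCAlpha_conj_id R hα1).mul hα0 hf) hz)
      ((integrableOn_conjKer_mul_sub hα0 hn hf hz).const_mul _)]
  congr 1; ext w
  simp only [conjKer, map_sub]; ring

theorem hasWirtingerAt_potential_critical {R : ℝ} {α : ℝ≥0} (hα0 : 0 < α) (hα1 : α < 1) {n : ℕ}
    {c : ℂ} (hc : ∀ z ∈ disk R, potential R n (n + 1) (fun _ => 1) z = c * conj z) {f : ℂ → ℂ}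
    (hf : MemCAlpha R α f) {z : ℂ} (hz : z ∈ disk R) :
    HasWirtingerAt R (potential R n (n + 1) f) ((n + 1) * regPotential R n (n + 2) f z)
      (-n * regPotential R (n - 1) (n + 1) f z + c * f z) z := by
  obtain ⟨C, hC⟩ := exists_norm_potential_taylor_le hα0 hα1 hc hf
  exact hasWirtingerAt_of_taylor (a := fun z => (n + 1) * regPotential R n (n + 2) f z)
    (b := fun z => -n * regPotential R (n - 1) (n + 1) f z + c * f z)
    (by exact_mod_cast hα0) hC hz

theorem wirtingerRegular_potential_critical {R : ℝ} (hR : 0 < R) {α : ℝ≥0} (hα0 : 0 < α)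
    (hα1 : α < 1) {n : ℕ} {c : ℂ}
    (hc : ∀ z ∈ disk R, potential R n (n + 1) (fun _ => 1) z = c * conj z) {f : ℂ → ℂ}
    (hf : MemCAlpha R α f) : WirtingerRegular R α 1 (potential R n (n + 1) f) := by
  obtain ⟨C, hC⟩ := exists_norm_potential_taylor_le hα0 hα1 hc hf
  have h := memCAlpha_of_taylor (a := fun z => (n + 1) * regPotential R n (n + 2) f z)
    (b := fun z => -n * regPotential R (n - 1) (n + 1) f z + c * f z) hR hC
  exact ⟨_, _, fun z hz => hasWirtingerAt_potential_critical hα0 hα1 hc hf hz, h⟩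

/-- Differentiation under the integral sign for the kernels `ū ^ m / u ^ (n + 1)` of nonnegative
degree. -/
theorem hasWirtingerAt_potential_of_lt {R : ℝ} {α : ℝ≥0} (hα0 : 0 < α) (hα1 : α < 1) {n : ℕ}
    {c : ℂ} (hc : ∀ z ∈ disk R, potential R n (n + 1) (fun _ => 1) z = c * conj z) {m : ℕ}
    (hm : n + 1 ≤ m) {f : ℂ → ℂ} (hf : MemCAlpha R α f) {z : ℂ} (hz : z ∈ disk R) :
    HasWirtingerAt R (potential R m (n + 1) f) ((n + 1) * potential R m (n + 2) f z)
      (-m * potential R (m - 1) (n + 1) f z) z := by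
  induction m, hm using Nat.le_induction generalizing f with
  | base =>
    -- The kernel of degree `0` is reduced to two critical ones; their terms in `c` cancel. The case
    -- `n = 0` is separate because `n - 1` truncates.
    have hf' := (memCAlpha_conj_id R hα1).mul hα0 hf
    have h := ((hasWirtingerAt_potential_critical hα0 hα1 hc hf' hz).sub
      (hasWirtingerAt_potential_critical hα0 hα1 hc hf hz).conj_mul).congr
      (fun x hx => potential_succ_left le_rfl (hf.continuousOn hα0) hx) hz
    convert h using 1
    · rw [potential_succ_eq_regPotential hα0 hα1 le_rfl hf hz]; ring
    · rw [Nat.add_sub_cancel]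
      rcases n with _ | n
      · simp; ring
      · rw [Nat.add_sub_cancel, potential_succ_eq_regPotential hα0 hα1 le_rfl hf hz]
        push_cast; ring
  | succ m hm ih =>
    have hf' := (memCAlpha_conj_id R hα1).mul hα0 hf
    have h := ((ih hf').sub (ih hf).conj_mul).congr
      (fun x hx => potential_succ_left (by omega) (hf.continuousOn hα0) hx) hz
    obtain ⟨l, rfl⟩ : ∃ l, m = l + 1 := ⟨m - 1, by omega⟩
    rw [Nat.add_sub_cancel] at h
    convert h using 1
    · rw [potential_succ_left (by omega) (hf.continuousOn hα0) hz]; ring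
    · rw [Nat.add_sub_cancel, potential_succ_left (by omega) (hf.continuousOn hα0) hz]
      push_cast; ring

theorem potential_one {R : ℝ} (m : ℕ) {z : ℂ} (hz : z ∈ disk R) :
    potential R m 1 (fun _ => 1) z =
      -(-1) ^ m * Real.pi / (m + 1) * conj z ^ (m + 1) := by
  have h := integral_disk_conj_sub_pow_div_sub m z hz
  have e : potential R m 1 (fun _ => 1) z =
      (-1) ^ m * ∫ ζ in disk R, (conj z - conj ζ) ^ m / (ζ - z) := by
    rw [potential, ← integral_const_mul]
    congr 1; ext ζ
    have hs : (-1 : ℂ) ^ m * (-1) ^ m = 1 := by rw [← mul_pow]; simp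
    rw [show conj z - conj ζ = -(conj ζ - conj z) by ring, neg_pow (conj ζ - conj z)]
    simp only [conjKer, map_sub, pow_one]
    linear_combination (-((conj ζ - conj z) ^ m / (ζ - z))) * hs
  rw [e, h, sub_self, zero_pow (Nat.succ_ne_zero m)]
  ring

/-- If the potential of `1` with denominator `u ^ (n + 1)` is a multiple of a power of `z̄`, its `∂`
vanishes; but this `∂` is `n + 1` times the potential with denominator `u ^ (n + 2)`. The induction
starts from the explicit `potential_one` and then continues with zero potentials. -/
theorem potential_add_two_one_eq_zero {R : ℝ} (hR : 0 < R) (n : ℕ) {m : ℕ} (hm : n + 1 ≤ m)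
    {z : ℂ} (hz : z ∈ disk R) : potential R m (n + 2) (fun _ => 1) z = 0 := by
  have key : ∀ (n m p : ℕ) (c d : ℂ), n + 1 ≤ m →
      (∀ z ∈ disk R, potential R n (n + 1) (fun _ => 1) z = c * conj z) →
      (∀ z ∈ disk R, potential R m (n + 1) (fun _ => 1) z = d * conj z ^ p) →
      ∀ z ∈ disk R, potential R m (n + 2) (fun _ => 1) z = 0 := by
    intro n m p c d hm hc hd z hz
    -- A constant is Hölder for every exponent, so `1 / 2` is an arbitrary choice.
    have h1 := hasWirtingerAt_potential_of_lt (α := 1 / 2) (by norm_num)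
      (by rw [← NNReal.coe_lt_coe]; norm_num) hc hm (memCAlpha_const R _ 1) hz
    have h2 := ((hasWirtingerAt_conj_pow R p z).const_mul d).congr hd hz
    have h3 := (h1.dz_eq hR hz).symm.trans (h2.dz_eq hR hz)
    rw [mul_zero, mul_eq_zero] at h3
    exact h3.resolve_left (by exact_mod_cast Nat.succ_ne_zero n)
  induction n generalizing m z with
  | zero =>
    refine key 0 m (m + 1) (-(-1) ^ 0 * Real.pi / ((0 : ℕ) + 1)) _ hm (fun z hz => ?_) (fun z hz => potential_one m hz) z hz
    rw [zero_add, potential_one 0 hz, zero_add, pow_one]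
  | succ n ih =>
    refine key (n + 1) m 0 0 0 hm (fun z hz => ?_) (fun z hz => ?_) z hz
    · rw [zero_mul]; exact ih le_rfl hz
    · rw [zero_mul]; exact ih (by omega) hz

theorem exists_potential_critical_one_eq {R : ℝ} (hR : 0 < R) (n : ℕ) :
    ∃ c : ℂ, ∀ z ∈ disk R, potential R n (n + 1) (fun _ => 1) z = c * conj z := by
  cases n with
  | zero => exact ⟨_, fun z hz => by rw [zero_add, potential_one 0 hz, zero_add, pow_one]⟩
  | succ n =>
    exact ⟨0, fun z hz => by rw [zero_mul]; exact potential_add_two_one_eq_zero hR n le_rfl hz⟩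

/-- The kernel has degree `d - 1`. Both `∂` (raising `n`) and `∂̄` (lowering the numerator) decrease
`d` by one, down to the critical case `d = 0`, where one derivative is gained. -/
theorem wirtingerRegular_potential {R : ℝ} (hR : 0 < R) {α : ℝ≥0} (hα0 : 0 < α) (hα1 : α < 1)
    {f : ℂ → ℂ} (hf : MemCAlpha R α f) (d n : ℕ) :
    WirtingerRegular R α (d + 1) (potential R (n + d) (n + 1) f) := by
  induction d generalizing n with
  | zero =>
    obtain ⟨c, hc⟩ := exists_potential_critical_one_eq hR n
    exact wirtingerRegular_potential_critical hR hα0 hα1 hc hf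
  | succ d ih =>
    obtain ⟨c, hc⟩ := exists_potential_critical_one_eq hR n
    refine ⟨_, _, fun z hz => hasWirtingerAt_potential_of_lt hα0 hα1 hc (by omega) hf hz, ?_, ?_⟩
    · have h := ih (n + 1)
      rw [show n + 1 + d = n + (d + 1) by ring] at h
      exact h.const_mul _
    · exact (ih n).const_mul _

/-! ### Fubini and the iterates -/

theorem exists_integral_norm_sub_rpow_le (R : ℝ) :
    ∃ K : ℝ, ∀ z ∈ disk R, ∫ w in disk R, ‖w - z‖ ^ (-1 : ℝ) ≤ K := by
  set G : ℂ → ℝ := (disk (2 * R)).indicator fun u => ‖u‖ ^ (-1 : ℝ) with hG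
  have hGi : Integrable G := by
    have := integrableOn_norm_sub_rpow (s := -1) (by norm_num) (2 * R) 0
    simp only [sub_zero] at this
    exact (integrable_indicator_iff (measurableSet_disk _)).2 this
  refine ⟨∫ u, G u, fun z hz => ?_⟩
  have hG0 : ∀ u, 0 ≤ G u := fun u => Set.indicator_nonneg (fun u _ => by positivity) u
  calc ∫ w in disk R, ‖w - z‖ ^ (-1 : ℝ) = ∫ w in disk R, G (w - z) := by
        refine setIntegral_congr_fun (measurableSet_disk R) fun w hw => ?_
        simp only [hG]
        rw [Set.indicator_of_mem (mem_disk.2 (norm_sub_le_of_mem_disk hz hw))]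
    _ ≤ ∫ w, G (w - z) := setIntegral_le_integral (hGi.comp_sub_right z)
        (Filter.Eventually.of_forall fun w => hG0 _)
    _ = ∫ u, G u := integral_sub_right_eq_self G z

/-- Tonelli: the inner integral over `w` of the norms is a constant, uniform in `ζ`, times the
integrable `‖ζ - z‖⁻¹`. -/
theorem integrable_prod_conjKer_mul {R : ℝ} (m : ℕ) {f : ℂ → ℂ}
    (hf : ContinuousOn f (disk R)) {z : ℂ} (hz : z ∈ disk R) :
    Integrable (Function.uncurry fun ζ w => conjKer m 1 (w - ζ) * f w / (ζ - z))
      ((volume.restrict (disk R)).prod (volume.restrict (disk R))) := by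
  have hR : 0 ≤ R := (norm_nonneg z).trans (mem_disk.1 hz)
  obtain ⟨B, hB⟩ := (isCompact_disk R).exists_bound_of_continuousOn hf
  obtain ⟨K, hK⟩ := exists_integral_norm_sub_rpow_le R
  have hB0 : 0 ≤ B := (norm_nonneg _).trans (hB z hz)
  have hmeas : AEStronglyMeasurable
      (Function.uncurry fun ζ w => conjKer m 1 (w - ζ) * f w / (ζ - z))
      ((volume.restrict (disk R)).prod (volume.restrict (disk R))) := by
    have h1 : Measurable fun p : ℂ × ℂ => conjKer m 1 (p.2 - p.1) :=
      (measurable_conjKer m 1).comp (measurable_snd.sub measurable_fst)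
    have h2 : Measurable fun p : ℂ × ℂ => (p.1 - z)⁻¹ := by fun_prop
    have h3 : AEStronglyMeasurable (fun p : ℂ × ℂ => f p.2)
        ((volume.restrict (disk R)).prod (volume.restrict (disk R))) :=
      (hf.aestronglyMeasurable (measurableSet_disk R) (μ := volume)).comp_snd
    exact (h1.aestronglyMeasurable.mul h3).mul h2.aestronglyMeasurable
  refine (integrable_prod_iff hmeas).2 ⟨?_, ?_⟩
  · filter_upwards [ae_restrict_mem (measurableSet_disk R)] with ζ hζ
    have h : IntegrableOn (fun w => conjKer m 1 (w - ζ) * f w) (disk R) :=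
      integrableOn_conjKer_mul (by omega) hf hζ
    exact h.div_const (ζ - z)
  · refine ((integrableOn_norm_sub_rpow (s := -1) (by norm_num) R z).const_mul
      ((2 * R) ^ m * K * B)).mono' hmeas.norm.integral_prod_right' ?_
    filter_upwards [ae_restrict_mem (measurableSet_disk R)] with ζ hζ
    rw [Real.norm_of_nonneg (integral_nonneg fun w => norm_nonneg _)]
    have hi := integrableOn_norm_sub_rpow (s := -1) (by norm_num) R ζ
    have hj : IntegrableOn (fun w => conjKer m 1 (w - ζ) * f w) (disk R) :=
      integrableOn_conjKer_mul (by omega) hf hζ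
    have hb : ∫ w in disk R, ‖conjKer m 1 (w - ζ) * f w / (ζ - z)‖ ≤
        ∫ w in disk R, (2 * R) ^ m * B * ‖ζ - z‖ ^ (-1 : ℝ) * ‖w - ζ‖ ^ (-1 : ℝ) := by
      refine integral_mono_ae (hj.div_const (ζ - z)).norm
        (hi.const_mul _) ?_
      filter_upwards [ae_restrict_mem (measurableSet_disk R), ae_ne_disk R ζ] with w hw hwζ
      rw [norm_div, norm_mul]
      calc _ ≤ (2 * R) ^ m * ‖w - ζ‖ ^ (-1 : ℝ) * B / ‖ζ - z‖ := by
            gcongr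
            · exact norm_conjKer_le (by omega) hζ hw hwζ
            · exact hB w hw
        _ = _ := by rw [Real.rpow_neg_one ‖ζ - z‖]; ring
    refine hb.trans ?_
    rw [integral_const_mul]
    calc _ ≤ (2 * R) ^ m * B * ‖ζ - z‖ ^ (-1 : ℝ) * K := by gcongr; exact hK ζ hζ
      _ = _ := by ring

theorem integrableOn_conj_sub_pow_div_sub (R : ℝ) (m : ℕ) (w : ℂ) {z : ℂ} (hz : z ∈ disk R) :
    IntegrableOn (fun ζ => (conj w - conj ζ) ^ m / (ζ - z)) (disk R) := by
  have hc : ContinuousOn (fun ζ => (conj w - conj ζ) ^ m) (disk R) :=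
    (Continuous.pow (continuous_const.sub Complex.continuous_conj) m).continuousOn
  refine (integrableOn_conjKer_mul (m := 0) (n := 1) (by omega) hc hz).congr
    (Filter.Eventually.of_forall fun ζ => ?_)
  simp only [conjKer]
  ring

/-- Partial fractions give the difference of one Cauchy transform at `z` and at `w`; the boundary
terms `w̄ ^ (m + 1)` cancel, and the transform at `w` contributes nothing else. -/
theorem integral_disk_conjKer_div_sub {R : ℝ} (m : ℕ) {w z : ℂ} (hw : w ∈ disk R)
    (hz : z ∈ disk R) (hwz : w ≠ z) :
    ∫ ζ in disk R, conjKer m 1 (w - ζ) / (ζ - z) =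
      Real.pi / (m + 1) * conjKer (m + 1) 1 (w - z) := by
  have hwz' : w - z ≠ 0 := sub_ne_zero.2 hwz
  have e : ∀ᵐ ζ ∂(volume.restrict (disk R)), conjKer m 1 (w - ζ) / (ζ - z) =
      (w - z)⁻¹ * ((conj w - conj ζ) ^ m / (ζ - z) - (conj w - conj ζ) ^ m / (ζ - w)) := by
    filter_upwards [ae_ne_disk R z, ae_ne_disk R w] with ζ h1 h2
    have h1' : ζ - z ≠ 0 := sub_ne_zero.2 h1
    have h2' : ζ - w ≠ 0 := sub_ne_zero.2 h2
    have h3' : w - ζ ≠ 0 := sub_ne_zero.2 h2.symm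
    simp only [conjKer, map_sub]
    field_simp
    ring
  rw [integral_congr_ae e, integral_const_mul,
    integral_sub (integrableOn_conj_sub_pow_div_sub R m w hz)
      (integrableOn_conj_sub_pow_div_sub R m w hw),
    integral_disk_conj_sub_pow_div_sub m w hz, integral_disk_conj_sub_pow_div_sub m w hw]
  have hm : (m : ℂ) + 1 ≠ 0 := by exact_mod_cast Nat.succ_ne_zero m
  simp only [conjKer, map_sub, sub_self]
  rw [zero_pow (Nat.succ_ne_zero m)]
  field_simp
  ring

theorem integral_potential_div_sub {R : ℝ} (m : ℕ) {f : ℂ → ℂ} (hf : ContinuousOn f (disk R))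
    {z : ℂ} (hz : z ∈ disk R) :
    ∫ ζ in disk R, potential R m 1 f ζ / (ζ - z) =
      Real.pi / (m + 1) * potential R (m + 1) 1 f z := by
  simp_rw [potential, ← integral_div]
  rw [integral_integral_swap (integrable_prod_conjKer_mul m hf hz), ← integral_const_mul]
  refine integral_congr_ae ?_
  filter_upwards [ae_restrict_mem (measurableSet_disk R), ae_ne_disk R z] with w hw hwz
  have : ∀ ζ, conjKer m 1 (w - ζ) * f w / (ζ - z) = f w * (conjKer m 1 (w - ζ) / (ζ - z)) := by
    intro ζ; ring
  simp_rw [this]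
  rw [integral_const_mul, integral_disk_conjKer_div_sub m hw hz hwz]
  ring

theorem wedgeIntegral_eq (S : Set ℂ) (g : ℂ → ℂ) :
    wedgeIntegral S g = (∫ ζ in S, g ζ) * (2 * Complex.I) := by
  rw [wedgeIntegral, conjWedge_one_I, integral_mul_const]

theorem opT_eq (R : ℝ) (f : ℂ → ℂ) (z : ℂ) :
    opT R f z = -(1 / Real.pi) * ∫ ζ in disk R, f ζ / (ζ - z) := by
  have hπ : (Real.pi : ℂ) ≠ 0 := by exact_mod_cast Real.pi_ne_zero
  rw [opT, wedgeIntegral_eq]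
  field_simp

theorem opTbar_conj (R : ℝ) (f : ℂ → ℂ) :
    opTbar R (fun z => conj (f z)) = fun z => conj (opT R f z) := by
  have hπ : (Real.pi : ℂ) ≠ 0 := by exact_mod_cast Real.pi_ne_zero
  ext z
  rw [opTbar, wedgeIntegral_eq, opT_eq, map_mul, ← integral_conj]
  simp only [map_div₀, map_sub, map_neg, map_one, Complex.conj_ofReal]
  field_simp

theorem opTbar_iterate (R : ℝ) (f : ℂ → ℂ) (k : ℕ) :
    (opTbar R)^[k] f = fun z => conj ((opT R)^[k] (fun z => conj (f z)) z) := by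
  have h : Function.Semiconj (fun (g : ℂ → ℂ) z => conj (g z)) (opT R) (opTbar R) :=
    fun g => (opTbar_conj R g).symm
  have := (h.iterate_right k) (fun z => conj (f z))
  simpa using this.symm

/-- Each further application of `T` contributes `-1 / π` from its definition and `π / (k + 1)` from
the composition of kernels. -/
theorem opT_iterate_succ {R : ℝ} {f : ℂ → ℂ} (hf : ContinuousOn f (disk R)) (k : ℕ) {z : ℂ}
    (hz : z ∈ disk R) :
    (opT R)^[k + 1] f z = (-1) ^ (k + 1) / (k.factorial * Real.pi) * potential R k 1 f z := by
  have hπ : (Real.pi : ℂ) ≠ 0 := by exact_mod_cast Real.pi_ne_zero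
  induction k generalizing z with
  | zero =>
    rw [zero_add, Function.iterate_one, opT_eq, potential]
    simp [conjKer, div_eq_inv_mul]
  | succ k ih =>
    rw [Function.iterate_succ_apply', opT_eq]
    have : ∫ ζ in disk R, (opT R)^[k + 1] f ζ / (ζ - z) =
        ∫ ζ in disk R, (-1) ^ (k + 1) / (k.factorial * Real.pi) *
          (potential R k 1 f ζ / (ζ - z)) := by
      refine setIntegral_congr_fun (measurableSet_disk R) fun ζ hζ => ?_
      simp only [ih hζ]; ring
    rw [this, integral_const_mul, integral_potential_div_sub k hf hz, Nat.factorial_succ]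
    have hk : (k : ℂ) + 1 ≠ 0 := by exact_mod_cast Nat.succ_ne_zero k
    have hk' : (k.factorial : ℂ) ≠ 0 := by exact_mod_cast k.factorial_ne_zero
    push_cast
    field_simp
    ring

theorem wirtingerRegular_opT_iterate {R : ℝ} (hR : 0 < R) {α : ℝ≥0} (hα0 : 0 < α) (hα1 : α < 1)
    {f : ℂ → ℂ} (hf : MemCAlpha R α f) (k : ℕ) :
    WirtingerRegular R α k ((opT R)^[k] f) := by
  cases k with
  | zero => exact hf
  | succ k =>
    have h := wirtingerRegular_potential hR hα0 hα1 hf k 0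
    rw [zero_add, zero_add] at h
    exact (h.const_mul _).congr fun z hz => opT_iterate_succ (hf.continuousOn hα0) k hz

/-! ### Absolute convergence and the single-integral formulas -/

theorem integrableOn_div_sub {R : ℝ} {f : ℂ → ℂ} (hf : ContinuousOn f (disk R)) {z : ℂ}
    (hz : z ∈ disk R) : IntegrableOn (fun ζ => f ζ / (ζ - z)) (disk R) := by
  refine (integrableOn_conjKer_mul (m := 0) (n := 1) (by omega) hf hz).congr
    (Filter.Eventually.of_forall fun ζ => ?_)
  simp only [conjKer]
  ring

theorem integrableOn_div_conj_sub {R : ℝ} {f : ℂ → ℂ} (hf : ContinuousOn f (disk R)) {z : ℂ}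
    (hz : z ∈ disk R) : IntegrableOn (fun ζ => f ζ / (conj ζ - conj z)) (disk R) := by
  have h := Complex.conjCLE.toContinuousLinearMap.integrable_comp
    (integrableOn_div_sub (Complex.continuous_conj.comp_continuousOn hf) hz)
  refine h.congr (Filter.Eventually.of_forall fun ζ => ?_)
  simp

theorem opT_iterate_eq_wedgeIntegral {R : ℝ} {f : ℂ → ℂ} (hf : ContinuousOn f (disk R)) {k : ℕ}
    (hk : 0 < k) {z : ℂ} (hz : z ∈ disk R) :
    (opT R)^[k] f z = (-1) ^ k / (((k - 1).factorial : ℂ) * (2 * Real.pi * Complex.I)) *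
      wedgeIntegral (disk R) fun ζ => (conj ζ - conj z) ^ (k - 1) * f ζ / (ζ - z) := by
  obtain ⟨k, rfl⟩ : ∃ l, k = l + 1 := ⟨k - 1, by omega⟩
  have hπ : (Real.pi : ℂ) ≠ 0 := by exact_mod_cast Real.pi_ne_zero
  have hk' : (k.factorial : ℂ) ≠ 0 := by exact_mod_cast k.factorial_ne_zero
  have e : potential R k 1 f z =
      ∫ ζ in disk R, (conj ζ - conj z) ^ k * f ζ / (ζ - z) := by
    rw [potential]
    congr 1; ext ζ
    simp only [conjKer, map_sub, pow_one]; ring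
  rw [opT_iterate_succ hf k hz, wedgeIntegral_eq, Nat.add_sub_cancel, e]
  field_simp

theorem opTbar_iterate_eq_wedgeIntegral {R : ℝ} {f : ℂ → ℂ} (hf : ContinuousOn f (disk R))
    {k : ℕ} (hk : 0 < k) {z : ℂ} (hz : z ∈ disk R) :
    (opTbar R)^[k] f z = (-1) ^ k / (((k - 1).factorial : ℂ) * (2 * Real.pi * Complex.I)) *
      wedgeIntegral (disk R) fun ζ => (ζ - z) ^ (k - 1) * f ζ / (conj ζ - conj z) := by
  have hf' : ContinuousOn (fun z => conj (f z)) (disk R) :=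
    Complex.continuous_conj.comp_continuousOn hf
  have hπ : (Real.pi : ℂ) ≠ 0 := by exact_mod_cast Real.pi_ne_zero
  have hk' : ((k - 1).factorial : ℂ) ≠ 0 := by exact_mod_cast (k - 1).factorial_ne_zero
  rw [opTbar_iterate]
  beta_reduce
  rw [opT_iterate_eq_wedgeIntegral hf' hk hz, wedgeIntegral_eq, wedgeIntegral_eq, map_mul, map_mul,
    ← integral_conj]
  simp only [map_div₀, map_mul, map_pow, map_neg, map_one, map_sub, Complex.conj_conj,
    Complex.conj_ofReal, Complex.conj_I, map_natCast, map_ofNat]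
  field_simp

end DiskGreen

theorem theorem2p1 (R : ℝ) (hR : 0 < R) (α : ℝ≥0) (hα0 : 0 < α) (hα1 : α < 1)
    (f : ℂ → ℂ) (hf : DiskGreen.MemCAlpha R α f) (k : ℕ) (hk : 0 < k) :
    -- the iterates have the asserted regularity
    DiskGreen.MemCkAlpha R k α ((DiskGreen.opT R)^[k] f) ∧
    DiskGreen.MemCkAlpha R k α ((DiskGreen.opTbar R)^[k] f) ∧
    ∀ z ∈ DiskGreen.disk R,
      -- all the integrals involved converge absolutely
      MeasureTheory.IntegrableOn
        (fun ζ : ℂ => ((DiskGreen.opT R)^[k - 1] f) ζ / (ζ - z)) (DiskGreen.disk R) ∧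
      MeasureTheory.IntegrableOn
        (fun ζ : ℂ => ((DiskGreen.opTbar R)^[k - 1] f) ζ / (starRingEnd ℂ ζ - starRingEnd ℂ z))
        (DiskGreen.disk R) ∧
      MeasureTheory.IntegrableOn
        (fun ζ : ℂ => (starRingEnd ℂ ζ - starRingEnd ℂ z) ^ (k - 1) * f ζ / (ζ - z))
        (DiskGreen.disk R) ∧
      MeasureTheory.IntegrableOn
        (fun ζ : ℂ => (ζ - z) ^ (k - 1) * f ζ / (starRingEnd ℂ ζ - starRingEnd ℂ z))
        (DiskGreen.disk R) ∧
      -- the single-integral formulas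
      ((DiskGreen.opT R)^[k] f) z =
        (-1) ^ k / (((k - 1).factorial : ℂ) * (2 * Real.pi * Complex.I)) *
          DiskGreen.wedgeIntegral (DiskGreen.disk R)
            (fun ζ => (starRingEnd ℂ ζ - starRingEnd ℂ z) ^ (k - 1) * f ζ / (ζ - z)) ∧
      ((DiskGreen.opTbar R)^[k] f) z =
        (-1) ^ k / (((k - 1).factorial : ℂ) * (2 * Real.pi * Complex.I)) *
          DiskGreen.wedgeIntegral (DiskGreen.disk R)
            (fun ζ => (ζ - z) ^ (k - 1) * f ζ / (starRingEnd ℂ ζ - starRingEnd ℂ z)) := by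
  open DiskGreen in
  have hfc := hf.continuousOn hα0
  have hT : ∀ l, WirtingerRegular R α l ((opT R)^[l] f) :=
    wirtingerRegular_opT_iterate hR hα0 hα1 hf
  -- `T̄ ^ l f` is the conjugate of `T ^ l` applied to `f̄`, and conjugation merely swaps the two
  -- Wirtinger derivatives up to conjugates.
  have hTbar : ∀ l, WirtingerRegular R α l ((opTbar R)^[l] f) := fun l => by
    rw [opTbar_iterate]
    exact (wirtingerRegular_opT_iterate hR hα0 hα1 hf.conj l).conj
  refine ⟨(hT k).memCkAlpha hR hα0, (hTbar k).memCkAlpha hR hα0, fun z hz => ?_⟩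
  refine ⟨integrableOn_div_sub ((hT _).contDiffOn hR hα0).continuousOn hz,
    integrableOn_div_conj_sub ((hTbar _).contDiffOn hR hα0).continuousOn hz,
    integrableOn_div_sub (ContinuousOn.mul (Continuous.continuousOn (by fun_prop)) hfc) hz,
    integrableOn_div_conj_sub (ContinuousOn.mul (Continuous.continuousOn (by fun_prop)) hfc) hz,
    opT_iterate_eq_wedgeIntegral hfc hk hz, opTbar_iterate_eq_wedgeIntegral hfc hk hz⟩
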